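/- Let $\Gamma$ be a set (the lattice) and let $\mathcal A$ be a unital $C^*$-algebra which is one of the following. (Spin) A quantum spin lattice system on $\Gamma$: to every finite $I\subset\Gamma$ there is a $*$-subalgebra $\mathcal A(I)\ni 1$ isomorphic to a full matrix algebra, with $\mathcal A(I\cup J)=\mathcal A(I)\otimes\mathcal A(J)$ for disjoint $I,J$ (the two subalgebras commute and the multiplication map $\mathcal A(I)\otimes\mathcal A(J)\to\mathcal A(I\cup J)$ is bijective), and $\bigcup_I\mathcal A(I)$ is dense in $\mathcal A$. (Fermion) A fermion lattice system on $\Gamma$: there are $c_i\in\mathcal A$ $(i\in\Gamma)$ with $c_i^*c_j+c_jc_i^*=\delta_{ij}1$ and $c_ic_j+c_jc_i=0$; $\mathcal A(I)$ is the unital $*$-algebra generated by $\{c_i: i\in I\}$ for finite $I$, and $\bigcup_I\mathcal A(I)$ is dense in $\mathcal A$. Let $\Theta$ be the $*$-automorphism of $\mathcal A$ with $\Theta(c_i)=-c_i$; an element or a state is even if it is invariant under $\Theta$. For an infinite $J\subset\Gamma$, $\mathcal A(J)$ is the $C^*$-subalgebra generated by the $\mathcal A(I)$ with $I\subset J$ finite.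 A potential is a map $\Phi$ with $\Phi(K)=\Phi(K)^*\in\mathcal A(K)$ for each finite $K\subset\Gamma$ (each $\Phi(K)$ even in the fermion case) such that for every finite $I$ the surface energy $H_{\partial I}=\sum_{K\cap I\ne\emptyset,\,K\cap I^c\neq\emptyset}\Phi(K)$ exists in $\mathcal A$, as the norm limit of the partial sums over $K\subset\Lambda$ as the finite set $\Lambda$ increases to $\Gamma$. For a state $\psi$ of $\mathcal A$ let $S_I(\psi)=-\mathrm{Tr}(D\log D)$, where $D$ is the density matrix of $\psi|_{\mathcal A(I)}$, and define the mutual entropy of $\psi$ between a finite $A\subset\Gamma$ and its complement by $$I_\psi(A:A^c)=S_A(\psi)-\inf_{\Lambda\subset A^c\text{ finite}}\bigl(S_{A\cup\Lambda}(\psi)-S_\Lambda(\psi)\bigr).$$ Let $\beta>0$, let $A\subset\Gamma$ be finite, let $\Phi$ be a potential, and let $\varphi$ be a state of $\mathcal A$, even in the fermion case, which satisfies the thermal area law $$I_\varphi(A:A^c)\le 2\beta\|H_{\partial A}\| .$$ Then there is exactly one state $\omega$ of $\mathcal A$ with $\omega(ab)=\varphi(a)\varphi(b)$ for all $a\in\mathcal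 A(A)$, $b\in\mathcal A(A^c)$, namely the product state, written $\varphi_A\otimes\varphi_{A^c}$ in the spin case and $\varphi_A\otimes_{\mathrm{car}}\varphi_{A^c}$ in the fermion case, and $$\|\omega-\varphi\|^2\le 4\beta\|H_{\partial A}\| .$$ Moreover $$|\varphi(\mathcal O_A\mathcal O_B)-\varphi(\mathcal O_A)\varphi(\mathcal O_B)|\le 2\,(\beta\|H_{\partial A}\|)^{1/2}$$ for all $\mathcal O_A\in\mathcal A(A)$ and $\mathcal O_B\in\mathcal A(A^c)$ with $\|\mathcal O_A\|\le1$ and $\|\mathcal O_B\|\le1$. -/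

import Mathlib

open scoped ComplexOrder Topology

namespace QuantumLattice

/-! ### States, local nets and entropies -/

section General

/-- A state of a unital C⋆-algebra: a positive normalized linear functional. (Positive functionals
are automatically bounded, so starting from bounded ones is no restriction.) -/
structure IsState {𝒜 : Type*} [CStarAlgebra 𝒜] (φ : StrongDual ℂ 𝒜) : Prop where
  map_one : φ 1 = 1
  nonneg : ∀ a : 𝒜, 0 ≤ φ (star a * a)

/-- The algebra of an arbitrary (finite or infinite) region `J`: the C⋆-subalgebra generated by the
local algebras of the finite subsets of `J`. -/
noncomputable def regionAlgebra {Γ 𝒜 : Type*} [CStarAlgebra 𝒜]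
    (alg : Finset Γ → StarSubalgebra ℂ 𝒜) (J : Set Γ) : StarSubalgebra ℂ 𝒜 :=
  (⨆ I : {I : Finset Γ // (I : Set Γ) ⊆ J}, alg I.1).topologicalClosure

/-- The density matrix of the restriction of `ψ` to a subalgebra `B` identified with a full matrix
algebra by `e`, with respect to the matrix trace: the matrix `D` for which
`ψ b = Tr (D * e b)` for all `b` in `B`. -/
noncomputable def densityMatrix {𝒜 : Type*} [CStarAlgebra 𝒜] {B : StarSubalgebra ℂ 𝒜} {n : ℕ}
    (e : B ≃⋆ₐ[ℂ] Matrix (Fin n) (Fin n) ℂ) (ψ : StrongDual ℂ 𝒜) : Matrix (Fin n) (Fin n) ℂ :=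
  Matrix.of fun i j => ψ (e.symm (Matrix.single j i 1) : 𝒜)

theorem trace_densityMatrix_mul {𝒜 : Type*} [CStarAlgebra 𝒜] {B : StarSubalgebra ℂ 𝒜} {n : ℕ}
    (e : B ≃⋆ₐ[ℂ] Matrix (Fin n) (Fin n) ℂ) (ψ : StrongDual ℂ 𝒜) (b : B) :
    (densityMatrix e ψ * e b).trace = ψ (b : 𝒜) := by
  let f : Matrix (Fin n) (Fin n) ℂ →ₗ[ℂ] ℂ :=
    { toFun := fun M => ψ (e.symm M : 𝒜)
      map_add' := by intros; simp
      map_smul' := by intros; simp }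
  have h1 : f (e b) = ψ (b : 𝒜) := by simp [f]
  have h2 : ∀ i j, densityMatrix e ψ i j = f (Matrix.single j i 1) := fun i j => rfl
  rw [← h1]
  conv_rhs => rw [Matrix.matrix_eq_sum_single (e b)]
  simp only [Matrix.trace, Matrix.diag, Matrix.mul_apply, map_sum, h2]
  rw [Finset.sum_comm]
  refine Finset.sum_congr rfl fun i _ => Finset.sum_congr rfl fun j _ => ?_
  have : Matrix.single i j (e b i j) = (e b i j) • Matrix.single i j (1 : ℂ) := by simp
  rw [this, map_smul, smul_eq_mul, mul_comm]

open Classical in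
/-- The von Neumann entropy `-Tr (D log D)` of the restriction of `ψ` to a subalgebra `B` which is
isomorphic to a full matrix algebra (it does not depend on the isomorphism, since automorphisms of
full matrix algebras are inner). The local algebras of the lattice systems below are all of this
form. -/
noncomputable def vonNeumannEntropy {𝒜 : Type*} [CStarAlgebra 𝒜] (B : StarSubalgebra ℂ 𝒜)
    (ψ : StrongDual ℂ 𝒜) : ℝ :=
  if h : ∃ n : ℕ, Nonempty (B ≃⋆ₐ[ℂ] Matrix (Fin n) (Fin n) ℂ) then
    -(densityMatrix h.choose_spec.some ψ *
      cfc Real.log (densityMatrix h.choose_spec.some ψ)).trace.re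
  else 0

open Classical in
/-- The conditional entropy of `ψ` on the finite region `I` given the region `J`: the infimum of
`S_{I ∪ Λ}(ψ) - S_Λ(ψ)` over the finite subsets `Λ` of `J`. -/
noncomputable def conditionalEntropy {Γ 𝒜 : Type*} [CStarAlgebra 𝒜]
    (alg : Finset Γ → StarSubalgebra ℂ 𝒜) (ψ : StrongDual ℂ 𝒜) (I : Finset Γ) (J : Set Γ) :
    EReal :=
  ⨅ Λ : {Λ : Finset Γ // (Λ : Set Γ) ⊆ J},
    ((vonNeumannEntropy (alg (I ∪ Λ.1)) ψ - vonNeumannEntropy (alg Λ.1) ψ : ℝ) : EReal)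

/-- The mutual entropy `S_I(ψ) - S_{I|J}(ψ)` of `ψ` between the finite region `I` and the disjoint
region `J`. -/
noncomputable def mutualEntropy {Γ 𝒜 : Type*} [CStarAlgebra 𝒜]
    (alg : Finset Γ → StarSubalgebra ℂ 𝒜) (ψ : StrongDual ℂ 𝒜) (I : Finset Γ) (J : Set Γ) :
    EReal :=
  (vonNeumannEntropy (alg I) ψ : EReal) - conditionalEntropy alg ψ I J

/-- `ω` is the product of the restrictions of `φ` to the region `A` and to its complement: a state
with `ω (a b) = φ a * φ b` for `a` in the algebra of `A` and `b` in the algebra of the complement.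
This is `φ_A ⊗ φ_{Aᶜ}` for spin systems and the product-state extension for fermion systems. -/
structure IsProductState {Γ 𝒜 : Type*} [CStarAlgebra 𝒜] (alg : Finset Γ → StarSubalgebra ℂ 𝒜)
    (φ : StrongDual ℂ 𝒜) (A : Finset Γ) (ω : StrongDual ℂ 𝒜) : Prop where
  isState : IsState ω
  map_mul : ∀ a ∈ alg A, ∀ b ∈ regionAlgebra alg (A : Set Γ)ᶜ, ω (a * b) = φ a * φ b

open Classical in
/-- The sum of the interaction terms `Φ K`, with `K` inside the finite window `Λ`, such that `K`
meets both `I` and its complement. -/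
noncomputable def surfaceSum {Γ 𝒜 : Type*} [CStarAlgebra 𝒜] (Φ : Finset Γ → 𝒜)
    (I Λ : Finset Γ) : 𝒜 :=
  ∑ K ∈ Λ.powerset.filter fun K : Finset Γ =>
    ((K : Set Γ) ∩ (I : Set Γ)).Nonempty ∧ ((K : Set Γ) ∩ (I : Set Γ)ᶜ).Nonempty, Φ K

/-- A potential: a self-adjoint `Φ K` in the local algebra of each finite `K`, such that for every
finite `I` the sum defining the surface energy of `I` converges in norm as the finite window grows
to the whole lattice. -/
structure Potential {Γ 𝒜 : Type*} [CStarAlgebra 𝒜] (alg : Finset Γ → StarSubalgebra ℂ 𝒜) where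
  toFun : Finset Γ → 𝒜
  isSelfAdjoint : ∀ K, IsSelfAdjoint (toFun K)
  mem : ∀ K, toFun K ∈ alg K
  surface_exists : ∀ I : Finset Γ, ∃ H : 𝒜,
    Filter.Tendsto (fun Λ : Finset Γ => surfaceSum toFun I Λ) Filter.atTop (𝓝 H)

/-- The surface energy `H_{∂I}`: the (unique) limit of the sums of all `Φ K` such that `K` meets
both `I` and its complement. -/
noncomputable def Potential.surfaceEnergy {Γ 𝒜 : Type*} [CStarAlgebra 𝒜]
    {alg : Finset Γ → StarSubalgebra ℂ 𝒜} (Φ : Potential alg) (I : Finset Γ) : 𝒜 :=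
  (Φ.surface_exists I).choose

end General

/-! ### Quantum spin lattice systems -/

section Spin

open Classical in
/-- A quantum spin lattice system on `Γ`: the local algebras are full matrix algebras, their union
is dense, and for disjoint `I`, `J` the algebra of `I ∪ J` is the tensor product of those of `I` and
`J` (they commute, and the multiplication map from their tensor product is injective with range
the algebra of `I ∪ J`). -/
structure SpinSystem (Γ 𝒜 : Type*) [CStarAlgebra 𝒜] where
  alg : Finset Γ → StarSubalgebra ℂ 𝒜
  matrix : ∀ I, ∃ k : ℕ, Nonempty (alg I ≃⋆ₐ[ℂ] Matrix (Fin k) (Fin k) ℂ)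
  commute : ∀ I J : Finset Γ, Disjoint I J → ∀ a ∈ alg I, ∀ b ∈ alg J, Commute a b
  mulMap_injective : ∀ I J : Finset Γ, Disjoint I J →
    Function.Injective (Submodule.mulMap (Subalgebra.toSubmodule (alg I).toSubalgebra)
      (Subalgebra.toSubmodule (alg J).toSubalgebra))
  mulMap_range : ∀ I J : Finset Γ, Disjoint I J →
    LinearMap.range (Submodule.mulMap (Subalgebra.toSubmodule (alg I).toSubalgebra)
      (Subalgebra.toSubmodule (alg J).toSubalgebra)) =
      Subalgebra.toSubmodule (alg (I ∪ J)).toSubalgebra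
  dense : Dense (⋃ I, (alg I : Set 𝒜))

end Spin

/-! ### Fermion lattice systems -/

section Fermion

open Classical in
/-- A fermion lattice system on `Γ`: annihilation operators `c i` satisfying the canonical
anticommutation relations, such that the local algebras generated by finitely many of them have a
dense union. -/
structure FermionSystem (Γ 𝒜 : Type*) [CStarAlgebra 𝒜] where
  c : Γ → 𝒜
  star_anticomm : ∀ i j, star (c i) * c j + c j * star (c i) = if i = j then 1 else 0
  anticomm : ∀ i j, c i * c j + c j * c i = 0
  dense : Dense (⋃ I : Finset Γ, (StarAlgebra.adjoin ℂ (c '' (I : Set Γ)) : Set 𝒜))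

namespace FermionSystem

variable {Γ 𝒜 : Type*} [CStarAlgebra 𝒜] (F : FermionSystem Γ 𝒜)

/-- The local algebra of a finite region. -/
noncomputable def alg (I : Finset Γ) : StarSubalgebra ℂ 𝒜 :=
  StarAlgebra.adjoin ℂ (F.c '' (I : Set Γ))

theorem alg_mono {I J : Finset Γ} (h : I ⊆ J) : F.alg I ≤ F.alg J :=
  StarAlgebra.adjoin_le ((Set.image_mono (Finset.coe_subset.2 h)).trans
    (StarAlgebra.subset_adjoin ℂ _))

theorem exists_local_parity (I : Finset Γ) : ∃ v : unitary 𝒜,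
    (∀ i ∈ I, (v : 𝒜) * F.c i * star (v : 𝒜) = -F.c i) ∧
      ∀ j ∉ I, (v : 𝒜) * F.c j * star (v : 𝒜) = F.c j := by
  classical
  induction I using Finset.induction_on with
  | empty => exact ⟨1, by simp, by simp⟩
  | insert i I hi ih =>
    obtain ⟨v, h1, h2⟩ := ih
    have cc : F.c i * F.c i = 0 := by
      have h := F.anticomm i i
      rw [← two_smul ℂ] at h
      simpa using h
    have sc : F.c i * star (F.c i) = 1 - star (F.c i) * F.c i := by
      have h := F.star_anticomm i i
      rw [if_pos rfl] at h
      exact eq_sub_of_add_eq' h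
    set n : 𝒜 := star (F.c i) * F.c i with hn
    have nc : n * F.c i = 0 := by rw [hn, mul_assoc, cc, mul_zero]
    have cn : F.c i * n = F.c i := by
      rw [hn, ← mul_assoc, sc, sub_mul, nc, one_mul, sub_zero]
    have nn : n * n = n := by
      nth_rewrite 1 [hn]
      rw [mul_assoc, cn]
    have sn : star n = n := by simp [hn]
    have nj : ∀ j, j ≠ i → n * F.c j = F.c j * n := by
      intro j hj
      have e1 : F.c i * F.c j = -(F.c j * F.c i) := eq_neg_of_add_eq_zero_left (F.anticomm i j)
      have e2 : star (F.c i) * F.c j = -(F.c j * star (F.c i)) := by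
        have h := F.star_anticomm i j
        rw [if_neg (Ne.symm hj)] at h
        exact eq_neg_of_add_eq_zero_left h
      rw [hn, mul_assoc, e1, mul_neg, ← mul_assoc, e2, neg_mul, neg_neg, mul_assoc]
    set u : 𝒜 := 1 - (n + n) with hu
    have su : star u = u := by simp [hu, sn]
    have uu : u * u = 1 := by
      simp only [hu, mul_sub, sub_mul, mul_add, add_mul, nn, mul_one, one_mul]
      abel
    have uc : u * F.c i * u = -F.c i := by
      have e1 : u * F.c i = F.c i := by simp [hu, sub_mul, add_mul, nc]
      rw [e1]
      simp [hu, mul_sub, mul_add, cn]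
    have uj : ∀ j, j ≠ i → u * F.c j * u = F.c j := by
      intro j hj
      have e1 : u * F.c j = F.c j * u := by
        simp [hu, sub_mul, add_mul, mul_sub, mul_add, nj j hj]
      rw [e1, mul_assoc, uu, mul_one]
    let w : unitary 𝒜 := ⟨u, by rw [Unitary.mem_iff, su]; exact ⟨uu, uu⟩⟩
    have key : ∀ x : 𝒜, ((v * w : unitary 𝒜) : 𝒜) * x * star ((v * w : unitary 𝒜) : 𝒜) =
        (v : 𝒜) * (u * x * u) * star (v : 𝒜) := by
      intro x
      have hw : (w : 𝒜) = u := rfl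
      simp only [Submonoid.coe_mul, hw, star_mul, su, mul_assoc]
    refine ⟨v * w, ?_, ?_⟩
    · intro j hj
      rw [key]
      rcases eq_or_ne j i with rfl | hne
      · rw [uc, mul_neg, neg_mul, h2 j hi]
      · rw [uj j hne, h1 j ((Finset.mem_insert.1 hj).resolve_left hne)]
    · intro j hj
      rw [Finset.mem_insert, not_or] at hj
      rw [key, uj j hj.1, h2 j hj.2]

open scoped CStarAlgebra in
theorem ext_hom {f g : 𝒜 →⋆ₐ[ℂ] 𝒜} (h : ∀ i, f (F.c i) = g (F.c i)) : f = g := by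
  have hloc : ∀ I : Finset Γ, F.alg I ≤ StarAlgHom.equalizer f g := fun I =>
    StarAlgHom.adjoin_le_equalizer f g (by rintro _ ⟨i, _, rfl⟩; exact h i)
  have : (f : 𝒜 → 𝒜) = g := by
    refine Continuous.ext_on F.dense (map_continuous f) (map_continuous g) ?_
    intro a ha
    obtain ⟨I, hI⟩ := Set.mem_iUnion.1 ha
    exact hloc I hI
  exact DFunLike.coe_injective this

/-- There is exactly one grading automorphism: the one with `c i ↦ -c i`. -/
theorem existsUnique_grading : ∃! Θ : 𝒜 ≃⋆ₐ[ℂ] 𝒜, ∀ i, Θ (F.c i) = -F.c i := by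
  classical
  choose v hv1 hv2 using F.exists_local_parity
  let θ : Finset Γ → 𝒜 ≃⋆ₐ[ℂ] 𝒜 := fun I => Unitary.conjStarAlgAut ℂ 𝒜 (v I)
  have hθ : ∀ I a, θ I a = (v I : 𝒜) * a * star (v I : 𝒜) := fun I a =>
    Unitary.conjStarAlgAut_apply _ _
  have hθc : ∀ I, ∀ i ∈ I, θ I (F.c i) = -F.c i := fun I i hi => by rw [hθ, hv1 I i hi]
  have hnorm : ∀ I a, ‖θ I a‖ = ‖a‖ := fun I a => by
    rw [hθ, ← Unitary.coe_star, CStarRing.norm_mul_coe_unitary, CStarRing.norm_coe_unitary_mul]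
  have hagree : ∀ I J, I ⊆ J → ∀ a ∈ F.alg I, θ J a = θ I a := by
    intro I J hIJ a ha
    have : F.alg I ≤ StarAlgHom.equalizer (θ J : 𝒜 →⋆ₐ[ℂ] 𝒜) (θ I : 𝒜 →⋆ₐ[ℂ] 𝒜) := by
      refine StarAlgHom.adjoin_le_equalizer _ _ ?_
      rintro _ ⟨i, hi, rfl⟩
      exact (hθc J i (hIJ hi)).trans (hθc I i hi).symm
    exact this ha
  have hlim : ∀ a, ∃ l, Filter.Tendsto (fun I => θ I a) Filter.atTop (𝓝 l) := by
    intro a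
    refine cauchySeq_tendsto_of_complete (Metric.cauchySeq_iff'.2 fun ε hε => ?_)
    obtain ⟨b, hb, hab⟩ := F.dense.exists_dist_lt a (half_pos hε)
    obtain ⟨I, hI⟩ := Set.mem_iUnion.1 hb
    refine ⟨I, fun J hJ => ?_⟩
    have e : θ J a - θ I a = θ J (a - b) - θ I (a - b) := by
      rw [map_sub, map_sub, hagree I J hJ b hI]; abel
    rw [dist_eq_norm, e]
    rw [dist_eq_norm] at hab
    calc ‖θ J (a - b) - θ I (a - b)‖ ≤ ‖θ J (a - b)‖ + ‖θ I (a - b)‖ := norm_sub_le _ _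
      _ < ε := by rw [hnorm, hnorm]; linarith
  choose L hL using hlim
  let T : 𝒜 →⋆ₐ[ℂ] 𝒜 :=
    { toFun := L
      map_one' := tendsto_nhds_unique (hL 1) (by simp)
      map_mul' := fun a b => tendsto_nhds_unique (hL (a * b)) (by
        simpa only [map_mul] using (hL a).mul (hL b))
      map_zero' := tendsto_nhds_unique (hL 0) (by simp)
      map_add' := fun a b => tendsto_nhds_unique (hL (a + b)) (by
        simpa only [map_add] using (hL a).add (hL b))
      commutes' := fun r => tendsto_nhds_unique (hL _) (by
        have : ∀ I, θ I (algebraMap ℂ 𝒜 r) = algebraMap ℂ 𝒜 r := fun I => by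
          rw [Algebra.algebraMap_eq_smul_one, map_smul, map_one]
        simp only [this]
        exact tendsto_const_nhds)
      map_star' := fun a => tendsto_nhds_unique (hL (star a)) (by
        simpa only [map_star] using (hL a).star) }
  have hTc : ∀ i, T (F.c i) = -F.c i := fun i => by
    refine tendsto_nhds_unique (hL (F.c i)) (tendsto_const_nhds.congr' ?_)
    filter_upwards [Filter.eventually_ge_atTop ({i} : Finset Γ)] with I hI
    exact (hθc I i (hI (Finset.mem_singleton_self i))).symm
  have hTT : T.comp T = StarAlgHom.id ℂ 𝒜 := F.ext_hom fun i => by simp [hTc]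
  refine ⟨StarAlgEquiv.ofStarAlgHom T T hTT hTT, hTc, ?_⟩
  intro Θ hΘ
  have : (Θ : 𝒜 →⋆ₐ[ℂ] 𝒜) = T := F.ext_hom fun i => (hΘ i).trans (hTc i).symm
  ext a
  exact DFunLike.congr_fun this a

/-- The fermion grading `Θ`: the automorphism with `Θ (c i) = -c i`. -/
noncomputable def grading : 𝒜 ≃⋆ₐ[ℂ] 𝒜 :=
  F.existsUnique_grading.choose

theorem grading_c (i : Γ) : F.grading (F.c i) = -F.c i :=
  F.existsUnique_grading.choose_spec.1 i

/-- A state is even if it is invariant under the grading. -/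
def IsEven (φ : StrongDual ℂ 𝒜) : Prop :=
  ∀ a, φ (F.grading a) = φ a

end FermionSystem

end Fermion

end QuantumLattice

/-! The finite-volume mutual entropy `S_A + S_Λ - S_{A ∪ Λ}` is the relative entropy of `φ` on the
region `A ∪ Λ` with respect to the product of its two marginals. Pinsker's inequality therefore
turns the area law into a norm bound. With `s = β‖H_{∂A}‖` it gives `‖ω - φ‖² ≤ 2 · 2s` on every
local algebra, with a constant independent of `Λ`. The bound extends to all of `𝒜` by density
(`area_law_of_local`), and the correlation estimate is its value at a product `ab`.

Pinsker's inequality with the sharp constant (`sq_trace_sub_le`) comes from an integral formula for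
the logarithm. The integrand is a matrix element of the resolvent of the relative modular operator.
This has a variational lower bound (`trace_quadratic_le`), into which a test operator `α + γY` is
inserted for the observable `Y` to be estimated. It is applied to self-adjoint contractions in
`sq_re_sub_le` and to general elements in `sq_norm_sub_le`.

The product state is written down explicitly as an average over matrix units of `𝒜(A)`
(`exists_state_mul_of_commute`). It is unique because products of elements of the two regions span
the local algebras.

For fermions the two regions do not commute. The Klein transform multiplies the odd part of an
element by the parity operator `v` of `A`. It maps the algebra of the complement into the commutant
of `𝒜(A)` and preserves even states, hence also the relevant density matrices. This reduces the
fermion case to commuting matrix algebras. -/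

namespace QuantumLattice

/-! ### A Pinsker inequality for density matrices -/

section Pinsker

/-- For positive `l` and `q`, `log l - log q` is the integral over `t > 0` of `l / (q + t l) - 1 /
(1 + t)`, while `δ² / (1 + t)³` integrates to `δ² / 2`. Integration is replaced by monotonicity: `g`
is an antiderivative of the difference of the two sides of `h`, and its value at `0` is compared
with its limit at infinity. -/
theorem sum_mul_log_sub_log_ge {κ : Type*} [Fintype κ] {u l q : κ → ℝ} {δ : ℝ}
    (hu1 : ∑ s, u s = 1) (hl : ∀ s, u s ≠ 0 → 0 < l s)
    (hq : ∀ s, u s ≠ 0 → 0 < q s)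
    (h : ∀ t > 0, 1 / (1 + t) + δ ^ 2 / (1 + t) ^ 3 ≤ ∑ s, u s * (l s / (q s + t * l s))) :
    δ ^ 2 / 2 ≤ ∑ s, u s * (Real.log (l s) - Real.log (q s)) := by
  let g : ℝ → ℝ := fun t => ∑ s, u s * (Real.log (q s + t * l s) - Real.log (1 + t)) +
    δ ^ 2 / 2 * ((1 + t) ^ 2)⁻¹
  have hpos : ∀ s, u s ≠ 0 → ∀ t : ℝ, 0 ≤ t → 0 < q s + t * l s := fun s hs t ht =>
    add_pos_of_pos_of_nonneg (hq s hs) (mul_nonneg ht (hl s hs).le)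
  have hderiv : ∀ t : ℝ, 0 ≤ t → HasDerivAt g
      (∑ s, u s * (l s / (q s + t * l s) - 1 / (1 + t)) +
        δ ^ 2 / 2 * (-(2 * (1 + t)) / ((1 + t) ^ 2) ^ 2)) t := by
    intro t ht
    have h1 : HasDerivAt (fun x : ℝ => 1 + x) 1 t := by
      simpa using (hasDerivAt_id t).const_add 1
    have ht1 : (1 + t) ≠ 0 := by positivity
    refine HasDerivAt.add (HasDerivAt.fun_sum fun s _ => ?_) ?_
    · by_cases hs : u s = 0
      · simpa [hs] using hasDerivAt_const t (0 : ℝ)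
      · refine HasDerivAt.const_mul _ (HasDerivAt.sub (HasDerivAt.log ?_ (hpos s hs t ht).ne')
          (h1.log ht1))
        simpa using ((hasDerivAt_id t).mul_const (l s)).const_add (q s)
    · refine HasDerivAt.const_mul _ (HasDerivAt.fun_inv ?_ (pow_ne_zero 2 ht1))
      simpa using h1.fun_pow 2
  have hmono : MonotoneOn g (Set.Ici 0) := by
    refine monotoneOn_of_deriv_nonneg (convex_Ici 0)
      (fun t ht => (hderiv t ht).continuousAt.continuousWithinAt)
      (fun t ht => (hderiv t (interior_subset ht)).differentiableAt.differentiableWithinAt) ?_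
    intro t ht
    rw [interior_Ici] at ht
    rw [(hderiv t ht.le).deriv]
    have ht' : (0 : ℝ) < 1 + t := by have : (0 : ℝ) < t := ht; positivity
    have e : ∑ s, u s * (l s / (q s + t * l s) - 1 / (1 + t)) =
        ∑ s, u s * (l s / (q s + t * l s)) - 1 / (1 + t) := by
      simp only [mul_sub, Finset.sum_sub_distrib, ← Finset.sum_mul, hu1, one_mul]
    have e2 : δ ^ 2 / 2 * (-(2 * (1 + t)) / ((1 + t) ^ 2) ^ 2) = - (δ ^ 2 / (1 + t) ^ 3) := by
      field_simp
    rw [e, e2]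
    linarith [h t ht]
  have hinv : Filter.Tendsto (fun t : ℝ => (1 + t)⁻¹) Filter.atTop (𝓝 0) :=
    tendsto_inv_atTop_zero.comp (Filter.tendsto_atTop_add_const_left _ 1 Filter.tendsto_id)
  have hlim : Filter.Tendsto g Filter.atTop (𝓝 (∑ s, u s * Real.log (l s) + δ ^ 2 / 2 * 0)) := by
    refine Filter.Tendsto.add (tendsto_finsetSum _ fun s _ => ?_) (Filter.Tendsto.const_mul _ ?_)
    · by_cases hs : u s = 0
      · simp [hs]
      refine Filter.Tendsto.const_mul _ ?_
      -- The quotient `(q + t l) / (1 + t)` equals `l + (q - l) / (1 + t)`, so the two divergent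
      -- logarithms combine into a convergent one.
      have h2 : Filter.Tendsto (fun t : ℝ => l s + (q s - l s) * (1 + t)⁻¹) Filter.atTop
          (𝓝 (l s)) := by
        simpa using (hinv.const_mul (q s - l s)).const_add (l s)
      refine (h2.log (hl s hs).ne').congr' ?_
      filter_upwards [Filter.eventually_ge_atTop 0] with t ht
      have ht' : (0 : ℝ) < 1 + t := by positivity
      rw [← Real.log_div (hpos s hs t ht).ne' ht'.ne']
      congr 1
      field_simp
      ring
    · simpa using hinv.pow 2
  have h0 : g 0 ≤ ∑ s, u s * Real.log (l s) + δ ^ 2 / 2 * 0 := by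
    refine ge_of_tendsto hlim ?_
    filter_upwards [Filter.eventually_ge_atTop 0] with t ht
    exact hmono Set.self_mem_Ici ht ht
  simp only [g, zero_mul, add_zero, Real.log_one, sub_zero, one_pow, inv_one, mul_one,
    mul_zero] at h0
  simp only [mul_sub, Finset.sum_sub_distrib]
  linarith

/-- This is a completed square in `‖k‖`. In the degenerate case `s = 0` both sides vanish, because
`l = 0`. -/
theorem two_mul_re_sub_le {u k : ℂ} {l s : ℝ} (hl : 0 ≤ l) (hs : s = 0 → l = 0) (hs0 : 0 ≤ s) :
    2 * l * (star u * k).re - s * ‖k‖ ^ 2 ≤ ‖u‖ ^ 2 * l * (l / s) := by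
  rcases hs0.eq_or_lt with h | h
  · simp [← h, hs h.symm]
  · have h1 : (star u * k).re ≤ ‖u‖ * ‖k‖ := by
      refine (Complex.re_le_norm _).trans ?_
      rw [norm_mul, norm_star]
    have h2 : ‖u‖ ^ 2 * l * (l / s) - (2 * l * (‖u‖ * ‖k‖) - s * ‖k‖ ^ 2) =
        s * (‖u‖ * l / s - ‖k‖) ^ 2 := by
      field_simp
      ring
    have h3 : 0 ≤ s * (‖u‖ * l / s - ‖k‖) ^ 2 := by positivity
    nlinarith

open Matrix in
/-- The quadratic lower bound for the resolvent form of the relative modular operator of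
`D = U diag(l) U*` and `diag(q)`. -/
theorem trace_quadratic_le {ι : Type*} [Fintype ι] [DecidableEq ι] {U K : Matrix ι ι ℂ}
    (hU : U * Uᴴ = 1) (hK : K.IsHermitian) {l q : ι → ℝ} (hl : ∀ i, 0 ≤ l i)
    (hq : ∀ j, 0 ≤ q j) {t : ℝ} (ht : 0 < t) :
    2 * (U * diagonal (fun i => (l i : ℂ)) * Uᴴ * K).trace.re
      - (diagonal (fun i => (q i : ℂ)) * (K * K)).trace.re
      - t * (U * diagonal (fun i => (l i : ℂ)) * Uᴴ * (K * K)).trace.re ≤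
    ∑ i, ∑ j, ‖U j i‖ ^ 2 * l i * (l i / (q j + t * l i)) := by
  -- The entries of `k` are those of `K` between the standard basis, which diagonalizes `diag(q)`,
  -- and the eigenbasis of `D`. In them the quadratic form decouples, and each entry is bounded
  -- separately.
  set k : Matrix ι ι ℂ := K * U with hk
  have hkH : kᴴ = Uᴴ * K := by rw [hk, conjTranspose_mul, hK.eq]
  have hKK : K * K = k * kᴴ := by
    rw [hkH, hk, Matrix.mul_assoc, ← Matrix.mul_assoc U, hU, Matrix.one_mul]
  have hns : ∀ z : ℂ, z * star z = ((‖z‖ ^ 2 : ℝ) : ℂ) := fun z => by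
    rw [RCLike.star_def, RCLike.mul_conj]; simp
  have hns' : ∀ z : ℂ, star z * z = ((‖z‖ ^ 2 : ℝ) : ℂ) := fun z => by rw [mul_comm, hns]
  have e1 : (U * diagonal (fun i => (l i : ℂ)) * Uᴴ * K).trace.re =
      ∑ i, ∑ j, l i * (star (U j i) * k j i).re := by
    have : (U * diagonal (fun i => (l i : ℂ)) * Uᴴ * K).trace =
        (diagonal (fun i => (l i : ℂ)) * (Uᴴ * k)).trace := by
      rw [hk, Matrix.mul_assoc, Matrix.mul_assoc, trace_mul_comm, Matrix.mul_assoc,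
        Matrix.mul_assoc]
    rw [this]
    simp only [trace, diag_apply, diagonal_mul]
    simp only [Matrix.mul_apply, conjTranspose_apply,
      Complex.re_sum, Complex.re_ofReal_mul, Finset.mul_sum]
  have e2 : (diagonal (fun i => (q i : ℂ)) * (K * K)).trace.re = ∑ i, ∑ j, q j * ‖k j i‖ ^ 2 := by
    rw [hKK, Finset.sum_comm]
    simp only [trace, diag_apply, diagonal_mul]
    simp only [Matrix.mul_apply, conjTranspose_apply, hns,
      Complex.re_sum, Complex.re_ofReal_mul, Finset.mul_sum, Complex.ofReal_re]
  have e3 : (U * diagonal (fun i => (l i : ℂ)) * Uᴴ * (K * K)).trace.re =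
      ∑ i, ∑ j, l i * ‖k j i‖ ^ 2 := by
    have : (U * diagonal (fun i => (l i : ℂ)) * Uᴴ * (K * K)).trace =
        (diagonal (fun i => (l i : ℂ)) * (kᴴ * k)).trace := by
      rw [hkH, hk, Matrix.mul_assoc, Matrix.mul_assoc, trace_mul_comm]
      simp only [Matrix.mul_assoc]
    rw [this]
    simp only [trace, diag_apply, diagonal_mul]
    simp only [Matrix.mul_apply, conjTranspose_apply, hns',
      Complex.re_sum, Complex.re_ofReal_mul, Finset.mul_sum, Complex.ofReal_re]
  rw [e1, e2, e3]
  simp only [Finset.mul_sum, ← Finset.sum_sub_distrib]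
  refine Finset.sum_le_sum fun i _ => Finset.sum_le_sum fun j _ => ?_
  have h := two_mul_re_sub_le (u := U j i) (k := k j i) (s := q j + t * l i) (hl i)
    (fun h => by
      have := hl i; have := hq j
      have h5 : t * l i = 0 := by have := mul_nonneg ht.le (hl i); linarith
      exact (mul_eq_zero.1 h5).resolve_left ht.ne')
    (add_nonneg (hq j) (mul_nonneg ht.le (hl i)))
  refine le_trans (le_of_eq ?_) h
  ring

open Matrix in
/-- **Pinsker's inequality**: the relative entropy of the density matrix `D = U diag(l) U*` with
respect to a diagonal density matrix bounds the difference of expectations of an observable `Y`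
whose second moments are at most one. -/
theorem sq_trace_sub_le {ι : Type*} [Fintype ι] [DecidableEq ι] {D U Y : Matrix ι ι ℂ}
    {l q : ι → ℝ} (hU : U * Uᴴ = 1) (hU' : Uᴴ * U = 1)
    (hspec : D = U * diagonal (fun i => (l i : ℂ)) * Uᴴ)
    (hl0 : ∀ i, 0 ≤ l i) (hl1 : ∑ i, l i = 1) (hq : ∀ j, 0 ≤ q j) (hq1 : ∑ j, q j = 1)
    (h0 : ∀ j, q j = 0 → D j j = 0) (hY : Y.IsHermitian) (hDY : (D * (Y * Y)).trace.re ≤ 1)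
    (hqY : (diagonal (fun i => (q i : ℂ)) * (Y * Y)).trace.re ≤ 1) :
    ((diagonal (fun i => (q i : ℂ)) * Y).trace.re - (D * Y).trace.re) ^ 2 ≤
      2 * (∑ i, l i * Real.log (l i) - ∑ j, (D j j).re * Real.log (q j)) := by
  have hns : ∀ z : ℂ, z * star z = ((‖z‖ ^ 2 : ℝ) : ℂ) := fun z => by
    rw [RCLike.star_def, RCLike.mul_conj]; simp
  have hcol : ∀ i, ∑ j, ‖U j i‖ ^ 2 = 1 := by
    intro i
    have h : (Uᴴ * U) i i = 1 := by rw [hU']; simp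
    simp only [Matrix.mul_apply, conjTranspose_apply, mul_comm (star _), hns] at h
    exact_mod_cast h
  have hdiag : ∀ j, D j j = ((∑ i, ‖U j i‖ ^ 2 * l i : ℝ) : ℂ) := by
    intro j
    rw [hspec]
    rw [Matrix.mul_apply]
    simp only [mul_diagonal, conjTranspose_apply]
    push_cast
    refine Finset.sum_congr rfl fun i _ => ?_
    rw [mul_right_comm, hns]
    push_cast
    ring
  have hterm : ∀ j, q j = 0 → ∀ i, ‖U j i‖ ^ 2 * l i = 0 := by
    intro j hj i
    have h := hdiag j
    rw [h0 j hj] at h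
    have h' : ∑ i, ‖U j i‖ ^ 2 * l i = 0 := by exact_mod_cast h.symm
    exact (Finset.sum_eq_zero_iff_of_nonneg fun i _ => mul_nonneg (sq_nonneg _) (hl0 i)).1 h' i
      (Finset.mem_univ i)
  set y := (D * Y).trace.re
  set z := (diagonal (fun i => (q i : ℂ)) * Y).trace.re
  have hq1' : (diagonal (fun i => (q i : ℂ))).trace.re = 1 := by
    simp [trace_diagonal, hq1]
  have hD1' : D.trace.re = 1 := by
    rw [hspec, trace_mul_comm, ← Matrix.mul_assoc, hU', Matrix.one_mul, trace_diagonal]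
    simp [hl1]
  have key : ∀ t > 0, 1 / (1 + t) + (z - y) ^ 2 / (1 + t) ^ 3 ≤
      ∑ s : ι × ι, (‖U s.2 s.1‖ ^ 2 * l s.1) * (l s.1 / (q s.2 + t * l s.1)) := by
    intro t ht
    have ht1 : 0 < 1 + t := by positivity
    -- With second moments bounded by one, the form at `α + γY` is at least `2(α + γy) - (1 + t)(α²
    -- + 2αγm + γ²)`. This `α` is optimal for given `γ`. This `γ` is optimal once the nonnegative
    -- term `(1 + t)(γm)²` is dropped.
    let m := (z + t * y) / (1 + t)
    let γ := (y - m) / (1 + t)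
    let α := 1 / (1 + t) - γ * m
    let K : Matrix ι ι ℂ := (α : ℂ) • (1 : Matrix ι ι ℂ) + (γ : ℂ) • Y
    have hK : K.IsHermitian := by
      have : Kᴴ = K := by
        simp [K, conjTranspose_add, conjTranspose_smul, hY.eq]
      exact this
    have h := trace_quadratic_le hU hK hl0 hq ht
    rw [← hspec] at h
    have hKK : K * K = ((α ^ 2 : ℝ) : ℂ) • (1 : Matrix ι ι ℂ) + ((2 * α * γ : ℝ) : ℂ) • Y +
        ((γ ^ 2 : ℝ) : ℂ) • (Y * Y) := by
      simp only [K, Matrix.add_mul, Matrix.mul_add, Matrix.smul_mul, Matrix.mul_smul,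
        Matrix.one_mul, Matrix.mul_one]
      push_cast
      module
    have tr : ∀ M : Matrix ι ι ℂ, M.trace.re = 1 →
        (M * K).trace.re = α + γ * (M * Y).trace.re ∧
        (M * (K * K)).trace.re = α ^ 2 + 2 * α * γ * (M * Y).trace.re +
          γ ^ 2 * (M * (Y * Y)).trace.re := by
      intro M hM
      constructor
      · rw [Matrix.mul_add, Matrix.mul_smul, Matrix.mul_smul, Matrix.mul_one]
        simp only [trace_add, trace_smul,
          smul_eq_mul, Complex.add_re, Complex.re_ofReal_mul, hM, mul_one]
      · rw [hKK]
        rw [Matrix.mul_add, Matrix.mul_add, Matrix.mul_smul, Matrix.mul_smul, Matrix.mul_smul,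
          Matrix.mul_one]
        simp only [trace_add, trace_smul,
          smul_eq_mul, Complex.add_re, Complex.re_ofReal_mul, hM, mul_one]
    rw [(tr D hD1').1, (tr D hD1').2, (tr _ hq1').2] at h
    rw [Fintype.sum_prod_type]
    refine le_trans ?_ h
    have hγ2 : γ ^ 2 * (D * (Y * Y)).trace.re ≤ γ ^ 2 := mul_le_of_le_one_right (sq_nonneg _) hDY
    have hγ3 : γ ^ 2 * (diagonal (fun i => (q i : ℂ)) * (Y * Y)).trace.re ≤ γ ^ 2 :=
      mul_le_of_le_one_right (sq_nonneg _) hqY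
    have hγ4 := mul_le_mul_of_nonneg_left hγ2 ht.le
    have hid : 1 / (1 + t) + (z - y) ^ 2 / (1 + t) ^ 3 + (1 + t) * (γ * m) ^ 2 =
        2 * (α + γ * y) - (α ^ 2 + 2 * α * γ * z + γ ^ 2)
        - t * (α ^ 2 + 2 * α * γ * y + γ ^ 2) := by
      simp only [α, γ, m]
      field_simp
      ring
    have : 0 ≤ (1 + t) * (γ * m) ^ 2 := by positivity
    linarith
  have hfin := sum_mul_log_sub_log_ge (κ := ι × ι) (u := fun s => ‖U s.2 s.1‖ ^ 2 * l s.1)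
    (l := fun s => l s.1) (q := fun s => q s.2) (δ := z - y)
    (by
      rw [Fintype.sum_prod_type]
      simp only [← Finset.sum_mul, hcol, one_mul, hl1])
    (fun s hs => (hl0 _).lt_of_ne' (right_ne_zero_of_mul hs))
    (fun s hs => (hq _).lt_of_ne' fun h => hs (hterm _ h _)) key
  -- The weights `‖U j i‖² l i` form a probability distribution whose marginals are `l` and the
  -- diagonal of `D`, so the classical sum is the quantum relative entropy.
  have e1 : ∑ s : ι × ι, ‖U s.2 s.1‖ ^ 2 * l s.1 * (Real.log (l s.1) - Real.log (q s.2)) =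
      ∑ i, l i * Real.log (l i) - ∑ j, (D j j).re * Real.log (q j) := by
    simp only [mul_sub, Finset.sum_sub_distrib]
    congr 1
    · rw [Fintype.sum_prod_type]
      simp only [mul_assoc, ← Finset.sum_mul, hcol, one_mul]
    · rw [Fintype.sum_prod_type, Finset.sum_comm]
      refine Finset.sum_congr rfl fun j _ => ?_
      rw [hdiag, Complex.ofReal_re, Finset.sum_mul]
  rw [e1] at hfin
  linarith

end Pinsker

/-! ### States -/

section States

variable {𝒜 : Type*} [CStarAlgebra 𝒜] {φ : StrongDual ℂ 𝒜}

theorem IsState.nontrivial (hφ : IsState φ) : Nontrivial 𝒜 := by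
  refine ⟨1, 0, fun h => ?_⟩
  have h1 := hφ.map_one
  rw [h, map_zero] at h1
  exact zero_ne_one h1

/-- Positivity makes the values at `a²` and at `(1 + a)² = 1 + 2a + a²` real, and their difference
isolates `a`. -/
theorem IsState.im_eq_zero (hφ : IsState φ) {a : 𝒜} (ha : IsSelfAdjoint a) : (φ a).im = 0 := by
  have h1 := (Complex.le_def.1 (hφ.nonneg (1 + a))).2
  have h2 := (Complex.le_def.1 (hφ.nonneg a)).2
  have e : star (1 + a) * (1 + a) = 1 + (2 : ℂ) • a + star a * a := by
    rw [star_add, star_one, ha.star_eq, two_smul]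
    noncomm_ring
  rw [e, map_add, map_add, map_smul, hφ.map_one] at h1
  simp at h1 h2
  linarith

theorem IsState.map_star (hφ : IsState φ) (a : 𝒜) : φ (star a) = star (φ a) := by
  have h1 := hφ.im_eq_zero (IsSelfAdjoint.add_star_self a)
  have h2 := hφ.im_eq_zero (a := Complex.I • (a - star a)) (by
    rw [IsSelfAdjoint, star_smul, star_sub, star_star, RCLike.star_def, Complex.conj_I]
    module)
  simp at h1 h2
  apply Complex.ext
  · simp; linarith
  · simp; linarith

/-- The element `‖a‖² - a⋆a` is positive, hence of the form `b⋆b`. This turns an operator norm bound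
into the second moment bounds needed for Pinsker's inequality. -/
theorem IsState.re_star_mul_self_le (hφ : IsState φ) (a : 𝒜) :
    (φ (star a * a)).re ≤ ‖a‖ ^ 2 := by
  let := CStarAlgebra.spectralOrder 𝒜
  let := CStarAlgebra.spectralOrderedRing 𝒜
  have h : 0 ≤ algebraMap ℝ 𝒜 (‖a‖ ^ 2) - star a * a :=
    sub_nonneg.2 CStarAlgebra.star_mul_le_algebraMap_norm_sq
  obtain ⟨b, hb⟩ := CStarAlgebra.nonneg_iff_eq_star_mul_self.1 h
  have h1 := hφ.nonneg b
  have e : algebraMap ℝ 𝒜 (‖a‖ ^ 2) = ((‖a‖ ^ 2 : ℝ) : ℂ) • (1 : 𝒜) := by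
    rw [Algebra.algebraMap_eq_smul_one]
    exact (Complex.coe_smul _ _).symm
  rw [← hb, e, map_sub, map_smul, hφ.map_one] at h1
  have h2 := (Complex.le_def.1 h1).1
  rw [Complex.sub_re, smul_eq_mul, mul_one, Complex.ofReal_re] at h2
  simpa using h2

end States

/-! ### Matrix subalgebras and their density matrices -/

section Representations

open Matrix

variable {𝒜 : Type*} [CStarAlgebra 𝒜] {φ : StrongDual ℂ 𝒜}
variable {ι κ : Type*} [Fintype ι] [DecidableEq ι] [Fintype κ] [DecidableEq κ]

/-- The density matrix of the restriction of `φ` to an embedded matrix algebra. -/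
noncomputable def repDensity (π : Matrix ι ι ℂ →⋆ₐ[ℂ] 𝒜) (φ : StrongDual ℂ 𝒜) : Matrix ι ι ℂ :=
  Matrix.of fun i j => φ (π (single j i 1))

theorem trace_repDensity_mul (π : Matrix ι ι ℂ →⋆ₐ[ℂ] 𝒜) (φ : StrongDual ℂ 𝒜)
    (X : Matrix ι ι ℂ) : (repDensity π φ * X).trace = φ (π X) := by
  have h2 : ∀ i j (c : ℂ), φ (π (single i j c)) = c * φ (π (single i j 1)) := fun i j c => by
    rw [← smul_eq_mul, ← map_smul, ← map_smul, smul_single, smul_eq_mul, mul_one]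
  conv_rhs => rw [matrix_eq_sum_single X]
  simp only [trace, diag, Matrix.mul_apply, map_sum, repDensity, of_apply]
  rw [Finset.sum_comm]
  refine Finset.sum_congr rfl fun i _ => Finset.sum_congr rfl fun j _ => ?_
  rw [h2 i j (X i j), mul_comm]

theorem eq_of_forall_trace_mul_eq {D D' : Matrix ι ι ℂ}
    (h : ∀ X, (D * X).trace = (D' * X).trace) : D = D' := by
  ext i j
  have := h (single j i 1)
  simpa [trace_mul_single] using this

theorem repDensity_isHermitian (hφ : IsState φ) (π : Matrix ι ι ℂ →⋆ₐ[ℂ] 𝒜) :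
    (repDensity π φ).IsHermitian := by
  ext i j
  rw [conjTranspose_apply, repDensity, of_apply, of_apply, ← hφ.map_star, ← map_star]
  congr 2
  rw [star_eq_conjTranspose, conjTranspose_single, star_one]

/-- Reindexing of matrices as a `⋆`-algebra isomorphism. -/
def reindexStarAlgEquiv (e : ι ≃ κ) : Matrix ι ι ℂ ≃⋆ₐ[ℂ] Matrix κ κ ℂ :=
  .ofAlgEquiv (Matrix.reindexAlgEquiv ℂ ℂ e) fun X => by
    ext i j
    simp [star_eq_conjTranspose]

theorem rep_injective [Nontrivial 𝒜] (π : Matrix ι ι ℂ →⋆ₐ[ℂ] 𝒜) : Function.Injective π := by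
  rcases isEmpty_or_nonempty ι with h | h
  · exact Function.injective_of_subsingleton _
  · exact RingHom.injective (π : Matrix ι ι ℂ →+* 𝒜)

/-- Two identifications of the same subalgebra differ by a `⋆`-isomorphism of matrix algebras, which
preserves the trace and commutes with the functional calculus. Any convenient representation can
therefore replace the arbitrarily chosen one. -/
theorem vonNeumannEntropy_range [Nontrivial 𝒜] (hφ : IsState φ) (π : Matrix ι ι ℂ →⋆ₐ[ℂ] 𝒜) :
    vonNeumannEntropy π.range φ =
      -(repDensity π φ * cfc Real.log (repDensity π φ)).trace.re := by
  let ε : Matrix ι ι ℂ ≃⋆ₐ[ℂ] π.range := StarAlgEquiv.ofInjective π (rep_injective π)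
  have h : ∃ n : ℕ, Nonempty (π.range ≃⋆ₐ[ℂ] Matrix (Fin n) (Fin n) ℂ) :=
    ⟨Fintype.card ι, ⟨ε.symm.trans (reindexStarAlgEquiv (Fintype.equivFin ι))⟩⟩
  rw [vonNeumannEntropy, dif_pos h]
  generalize h.choose_spec.some = e
  let α := ε.trans e
  have hα : ∀ X, (α X).trace = X.trace := fun X => Matrix.trace_map α X
  have hD : densityMatrix e φ = α (repDensity π φ) := by
    refine eq_of_forall_trace_mul_eq fun X => ?_
    obtain ⟨Y, rfl⟩ : ∃ Y, α Y = X := ⟨α.symm X, α.apply_symm_apply X⟩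
    rw [← map_mul, hα, trace_repDensity_mul]
    exact trace_densityMatrix_mul e φ (ε Y)
  have hc : cfc Real.log (α (repDensity π φ)) = α (cfc Real.log (repDensity π φ)) := by
    refine (StarAlgHomClass.map_cfc (S := ℂ) α Real.log (repDensity π φ) ?_ ?_ ?_ ?_).symm
    · exact (Matrix.finite_real_spectrum).continuousOn _
    · exact LinearMap.continuous_of_finiteDimensional α.toAlgEquiv.toLinearMap
    · exact repDensity_isHermitian hφ π
    · exact (show IsSelfAdjoint _ from repDensity_isHermitian hφ π).map α
  rw [hD, hc, ← map_mul, hα]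

/-- Spectral decomposition of the density matrix of a state on an embedded matrix algebra. -/
theorem exists_spectral_repDensity (hφ : IsState φ) (π : Matrix ι ι ℂ →⋆ₐ[ℂ] 𝒜) :
    ∃ (U : Matrix ι ι ℂ) (l : ι → ℝ), U * Uᴴ = 1 ∧ Uᴴ * U = 1 ∧
      repDensity π φ = U * diagonal (fun i => (l i : ℂ)) * Uᴴ ∧ (∀ i, 0 ≤ l i) ∧ ∑ i, l i = 1 ∧
      vonNeumannEntropy π.range φ = -∑ i, l i * Real.log (l i) := by
  have := hφ.nontrivial
  have hD := repDensity_isHermitian hφ π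
  obtain ⟨U, l, hU, hU', hspec, hc⟩ : ∃ (U : Matrix ι ι ℂ) (l : ι → ℝ), U * Uᴴ = 1 ∧
      Uᴴ * U = 1 ∧ repDensity π φ = U * diagonal (fun i => (l i : ℂ)) * Uᴴ ∧
      cfc Real.log (repDensity π φ) = U * diagonal (fun i => (Real.log (l i) : ℂ)) * Uᴴ := by
    refine ⟨hD.eigenvectorUnitary.1, hD.eigenvalues,
      Unitary.mul_star_self_of_mem hD.eigenvectorUnitary.2,
      Unitary.star_mul_self_of_mem hD.eigenvectorUnitary.2, ?_, ?_⟩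
    · conv_lhs => rw [hD.spectral_theorem, Unitary.conjStarAlgAut_apply]
      rfl
    · rw [hD.cfc_eq, Matrix.IsHermitian.cfc, Unitary.conjStarAlgAut_apply]
      rfl
  have htr : ∀ X, φ (π (U * X * Uᴴ)) = ∑ i, (l i : ℂ) * X i i := fun X => by
    rw [← trace_repDensity_mul, hspec, trace_mul_comm]
    have : U * X * Uᴴ * (U * diagonal (fun i => (l i : ℂ)) * Uᴴ) =
        U * (X * (Uᴴ * U) * diagonal (fun i => (l i : ℂ))) * Uᴴ := by
      simp only [Matrix.mul_assoc]
    rw [this, hU', Matrix.mul_one, trace_mul_comm, ← Matrix.mul_assoc, hU', Matrix.one_mul,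
      trace_mul_comm]
    simp only [trace, diag_apply, diagonal_mul]
  refine ⟨U, l, hU, hU', hspec, fun i => ?_, ?_, ?_⟩
  · have h1 := htr (single i i 1)
    have h2 : U * single i i (1 : ℂ) * Uᴴ =
        star (U * single i i (1 : ℂ) * Uᴴ) * (U * single i i (1 : ℂ) * Uᴴ) := by
      have : star (U * single i i (1 : ℂ) * Uᴴ) = U * single i i (1 : ℂ) * Uᴴ := by
        simp [star_eq_conjTranspose, Matrix.mul_assoc]
      rw [this]
      calc U * single i i (1 : ℂ) * Uᴴ
          = U * (single i i (1 : ℂ) * (Uᴴ * U) * single i i (1 : ℂ)) * Uᴴ := by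
            rw [hU', Matrix.mul_one, single_mul_single_same, mul_one]
        _ = _ := by simp only [Matrix.mul_assoc]
    rw [h2, map_mul, map_star] at h1
    have h3 := hφ.nonneg (π (U * single i i (1 : ℂ) * Uᴴ))
    rw [h1, Finset.sum_eq_single i (fun j _ hj => by simp [hj.symm])
      (by simp)] at h3
    simpa using h3
  · have h1 := htr 1
    rw [Matrix.mul_one, hU, map_one, hφ.map_one] at h1
    simp only [one_apply_eq, mul_one] at h1
    exact_mod_cast h1.symm
  · rw [vonNeumannEntropy_range hφ, trace_repDensity_mul, hc, htr]
    simp only [diagonal_apply_eq]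
    norm_cast

/-- Every state is diagonal in suitable matrix units of a given matrix subalgebra. -/
theorem exists_diagonal_rep (hφ : IsState φ) (π : Matrix ι ι ℂ →⋆ₐ[ℂ] 𝒜) :
    ∃ (π' : Matrix ι ι ℂ →⋆ₐ[ℂ] 𝒜) (l : ι → ℝ), π'.range = π.range ∧ (∀ i, 0 ≤ l i) ∧
      ∑ i, l i = 1 ∧ (∀ X, φ (π' X) = ∑ i, (l i : ℂ) * X i i) ∧
      vonNeumannEntropy π.range φ = -∑ i, l i * Real.log (l i) := by
  obtain ⟨U, l, hU, hU', hspec, hl0, hl1, hS⟩ := exists_spectral_repDensity hφ π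
  -- Conjugation by the eigenvector unitary changes the matrix units but not the range.
  let V : unitary (Matrix ι ι ℂ) := ⟨U, Unitary.mem_iff.2 ⟨hU', hU⟩⟩
  let α := Unitary.conjStarAlgAut ℂ (Matrix ι ι ℂ) V
  refine ⟨π.comp (α : Matrix ι ι ℂ →⋆ₐ[ℂ] Matrix ι ι ℂ), l, ?_, hl0, hl1, fun X => ?_, hS⟩
  · ext x
    constructor
    · rintro ⟨X, rfl⟩
      exact ⟨α X, rfl⟩
    · rintro ⟨X, rfl⟩
      exact ⟨α.symm X, congrArg π (α.apply_symm_apply X)⟩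
  · have e : (π.comp (α : Matrix ι ι ℂ →⋆ₐ[ℂ] Matrix ι ι ℂ)) X = π (U * X * Uᴴ) := rfl
    rw [e, ← trace_repDensity_mul, hspec, trace_mul_comm]
    have : U * X * Uᴴ * (U * diagonal (fun i => (l i : ℂ)) * Uᴴ) =
        U * (X * (Uᴴ * U) * diagonal (fun i => (l i : ℂ))) * Uᴴ := by
      simp only [Matrix.mul_assoc]
    rw [this, hU', Matrix.mul_one, trace_mul_comm, ← Matrix.mul_assoc, hU', Matrix.one_mul,
      trace_mul_comm]
    simp only [trace, diag_apply, diagonal_mul]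

/-! ### Products of commuting matrix subalgebras -/

open scoped Kronecker TensorProduct

/-- The representation of the matrices on a product index set given by two commuting
representations. -/
noncomputable def prodRep (π₁ : Matrix ι ι ℂ →⋆ₐ[ℂ] 𝒜) (π₂ : Matrix κ κ ℂ →⋆ₐ[ℂ] 𝒜)
    (h : ∀ a b, Commute (π₁ a) (π₂ b)) : Matrix (ι × κ) (ι × κ) ℂ →⋆ₐ[ℂ] 𝒜 :=
  let f : Matrix ι ι ℂ ⊗[ℂ] Matrix κ κ ℂ →ₐ[ℂ] 𝒜 :=
    Algebra.TensorProduct.lift π₁.toAlgHom π₂.toAlgHom h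
  let g : Matrix ι ι ℂ ⊗[ℂ] Matrix κ κ ℂ →⋆ₐ[ℂ] 𝒜 :=
    { f with
      map_star' := fun x => by
        induction x with
        | zero => simp
        | add x y hx hy =>
          simp only [AlgHom.toRingHom_eq_coe, RingHom.toMonoidHom_eq_coe, OneHom.toFun_eq_coe,
            MonoidHom.toOneHom_coe, MonoidHom.coe_coe, RingHom.coe_coe, star_add, map_add] at *
          rw [hx, hy]
        | tmul a b =>
          change f (star (a ⊗ₜ b)) = star (f (a ⊗ₜ b))
          have e : ∀ a b, f (a ⊗ₜ b) = π₁ a * π₂ b := fun a b =>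
            Algebra.TensorProduct.lift_tmul _ _ _ _ _
          rw [TensorProduct.star_tmul, e, e, star_mul, map_star, map_star, ← map_star π₁,
            ← map_star π₂]
          exact h _ _ }
  g.comp (kroneckerStarAlgEquiv ι κ ℂ).symm

theorem prodRep_kronecker (π₁ : Matrix ι ι ℂ →⋆ₐ[ℂ] 𝒜) (π₂ : Matrix κ κ ℂ →⋆ₐ[ℂ] 𝒜)
    (h : ∀ a b, Commute (π₁ a) (π₂ b)) (a : Matrix ι ι ℂ) (b : Matrix κ κ ℂ) :
    prodRep π₁ π₂ h (a ⊗ₖ b) = π₁ a * π₂ b := by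
  have e : (kroneckerStarAlgEquiv ι κ ℂ).symm (a ⊗ₖ b) = a ⊗ₜ b := by
    rw [StarAlgEquiv.symm_apply_eq]
    simp
  change Algebra.TensorProduct.lift π₁.toAlgHom π₂.toAlgHom h
    ((kroneckerStarAlgEquiv ι κ ℂ).symm (a ⊗ₖ b)) = _
  rw [e, Algebra.TensorProduct.lift_tmul]
  rfl

theorem prod_matrix_induction {p : Matrix (ι × κ) (ι × κ) ℂ → Prop}
    (hadd : ∀ X Y, p X → p Y → p (X + Y)) (hzero : p 0)
    (hk : ∀ a b, p (a ⊗ₖ b)) (X : Matrix (ι × κ) (ι × κ) ℂ) : p X := by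
  obtain ⟨T, rfl⟩ : ∃ T, kroneckerStarAlgEquiv ι κ ℂ T = X :=
    ⟨(kroneckerStarAlgEquiv ι κ ℂ).symm X, (kroneckerStarAlgEquiv ι κ ℂ).apply_symm_apply X⟩
  induction T with
  | zero => simpa using hzero
  | add x y hx hy => rw [map_add]; exact hadd _ _ hx hy
  | tmul a b => simpa using hk a b

theorem prodRep_range (π₁ : Matrix ι ι ℂ →⋆ₐ[ℂ] 𝒜) (π₂ : Matrix κ κ ℂ →⋆ₐ[ℂ] 𝒜)
    (h : ∀ a b, Commute (π₁ a) (π₂ b)) : (prodRep π₁ π₂ h).range = π₁.range ⊔ π₂.range := by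
  apply le_antisymm
  · rintro _ ⟨X, rfl⟩
    change prodRep π₁ π₂ h X ∈ _
    induction X using prod_matrix_induction with
    | hadd X Y hX hY => rw [map_add]; exact add_mem hX hY
    | hzero => rw [map_zero]; exact zero_mem _
    | hk a b =>
      rw [prodRep_kronecker]
      exact mul_mem ((le_sup_left : π₁.range ≤ π₁.range ⊔ π₂.range) ⟨a, rfl⟩)
        ((le_sup_right : π₂.range ≤ π₁.range ⊔ π₂.range) ⟨b, rfl⟩)
  · refine sup_le ?_ ?_
    · rintro _ ⟨a, rfl⟩
      exact ⟨a ⊗ₖ 1, (prodRep_kronecker π₁ π₂ h a 1).trans (by rw [map_one, mul_one]; rfl)⟩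
    · rintro _ ⟨b, rfl⟩
      exact ⟨1 ⊗ₖ b, (prodRep_kronecker π₁ π₂ h 1 b).trans (by rw [map_one, one_mul]; rfl)⟩

/-- Functionals that agree on products agree on the algebra generated by two commuting matrix
subalgebras. -/
theorem eq_on_prodRep (π₁ : Matrix ι ι ℂ →⋆ₐ[ℂ] 𝒜) (π₂ : Matrix κ κ ℂ →⋆ₐ[ℂ] 𝒜)
    (h : ∀ a b, Commute (π₁ a) (π₂ b)) {ω ω' : StrongDual ℂ 𝒜}
    (hω : ∀ a b, ω (π₁ a * π₂ b) = ω' (π₁ a * π₂ b)) (X : Matrix (ι × κ) (ι × κ) ℂ) :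
    ω (prodRep π₁ π₂ h X) = ω' (prodRep π₁ π₂ h X) := by
  induction X using prod_matrix_induction with
  | hadd X Y hX hY => rw [map_add, map_add, map_add, hX, hY]
  | hzero => simp
  | hk a b => rw [prodRep_kronecker, hω]

end Representations

/-! ### Product states and their distance -/

section Products

open Matrix
open scoped Kronecker

variable {𝒜 : Type*} [CStarAlgebra 𝒜] {φ ω : StrongDual ℂ 𝒜}
variable {ι κ : Type*} [Fintype ι] [DecidableEq ι] [Fintype κ] [DecidableEq κ]

/-- The product of the restriction of a state to a matrix subalgebra and of its restriction to the
commutant exists as a state of the whole algebra. -/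
theorem exists_state_mul_of_commute (hφ : IsState φ) (π : Matrix ι ι ℂ →⋆ₐ[ℂ] 𝒜) {l : ι → ℝ}
    (hl0 : ∀ i, 0 ≤ l i) (hπ : ∀ X, φ (π X) = ∑ i, (l i : ℂ) * X i i) :
    ∃ ω : StrongDual ℂ 𝒜, IsState ω ∧
      ∀ X b, (∀ Y, Commute (π Y) b) → ω (π X * b) = φ (π X) * φ b := by
  -- With matrix units `e`, the map `x ↦ ∑ m, e_{mk} x e_{km}` sends `π X * b` to `X k k • b` when
  -- `b` commutes with the range of `π`. Averaging with the eigenvalues `l k` produces the factor `φ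
  -- (π X)`. Positivity is visible term by term, and `ω` is defined on all of `𝒜`.
  let ω : StrongDual ℂ 𝒜 := ∑ k, ∑ m, (l k : ℂ) •
    (φ.comp (ContinuousLinearMap.mulLeftRight ℂ 𝒜 (π (single m k 1)) (π (single k m 1))))
  have hω : ∀ x, ω x = ∑ k, ∑ m, (l k : ℂ) * φ (π (single m k 1) * x * π (single k m 1)) := by
    intro x
    simp [ω]
  have hprod : ∀ X b, (∀ Y, Commute (π Y) b) → ω (π X * b) = φ (π X) * φ b := by
    intro X b hb
    have h1 : ∀ k m, φ (π (single m k 1) * (π X * b) * π (single k m 1)) =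
        X k k * φ (π (single m m 1) * b) := by
      intro k m
      have e : π (single m k 1) * (π X * b) * π (single k m 1) =
          π (single m k 1 * X * single k m 1) * b := by
        rw [map_mul, map_mul, mul_assoc, mul_assoc (π X), ← (hb (single k m 1)).eq]
        simp only [mul_assoc]
      have e2 : single m k 1 * X * single k m 1 = X k k • single m m (1 : ℂ) := by
        rw [single_mul_mul_single]
        simp
      rw [e, e2, map_smul, smul_mul_assoc, map_smul, smul_eq_mul]
    have h2 : ∑ m, φ (π (single m m 1) * b) = φ b := by
      rw [← map_sum, ← Finset.sum_mul, ← map_sum, sum_single_one, map_one, one_mul]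
    rw [hω, hπ, Finset.sum_mul]
    refine Finset.sum_congr rfl fun k _ => ?_
    simp only [h1]
    rw [← Finset.mul_sum, ← Finset.mul_sum, h2, mul_assoc]
  refine ⟨ω, ⟨?_, fun a => ?_⟩, hprod⟩
  · have h := hprod 1 1 (fun _ => Commute.one_right _)
    rw [map_one, one_mul, hφ.map_one, one_mul] at h
    exact h
  · rw [hω]
    refine Finset.sum_nonneg fun k _ => Finset.sum_nonneg fun m _ => mul_nonneg ?_ ?_
    · exact_mod_cast hl0 k
    · have e : π (single m k 1) * (star a * a) * π (single k m 1) =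
          star (a * π (single k m 1)) * (a * π (single k m 1)) := by
        rw [star_mul, ← map_star, star_eq_conjTranspose, conjTranspose_single, star_one]
        simp only [mul_assoc]
      rw [e]
      exact hφ.nonneg _

/-- The entropic bound on the distance of a state to a product state on self-adjoint elements. -/
theorem sq_re_sub_le (hφ : IsState φ) (hω : IsState ω) (π₁ : Matrix ι ι ℂ →⋆ₐ[ℂ] 𝒜)
    (π₂ : Matrix κ κ ℂ →⋆ₐ[ℂ] 𝒜) (h : ∀ a b, Commute (π₁ a) (π₂ b)) {l : ι → ℝ} {q : κ → ℝ}
    (hl0 : ∀ i, 0 ≤ l i) (hq0 : ∀ i, 0 ≤ q i) (hl1 : ∑ i, l i = 1) (hq1 : ∑ i, q i = 1)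
    (hπ₁ : ∀ X, φ (π₁ X) = ∑ i, (l i : ℂ) * X i i) (hπ₂ : ∀ X, φ (π₂ X) = ∑ i, (q i : ℂ) * X i i)
    (hprod : ∀ a b, ω (π₁ a * π₂ b) = φ (π₁ a) * φ (π₂ b)) {Y : Matrix (ι × κ) (ι × κ) ℂ}
    (hY : Y.IsHermitian) (hY1 : ‖prodRep π₁ π₂ h Y‖ ≤ 1) :
    ((ω (prodRep π₁ π₂ h Y)).re - (φ (prodRep π₁ π₂ h Y)).re) ^ 2 ≤
      2 * (-(∑ i, l i * Real.log (l i)) - ∑ j, q j * Real.log (q j) -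
        vonNeumannEntropy (prodRep π₁ π₂ h).range φ) := by
  set π := prodRep π₁ π₂ h
  have hk := prodRep_kronecker π₁ π₂ h
  obtain ⟨U, r, hU, hU', hspec, hr0, hr1, hS⟩ := exists_spectral_repDensity hφ π
  set D := repDensity π φ with hD
  have hDtr : ∀ X, (D * X).trace = φ (π X) := trace_repDensity_mul π φ
  let p : ι × κ → ℝ := fun s => l s.1 * q s.2
  have hωtr : ∀ X, (diagonal (fun s => (p s : ℂ)) * X).trace = ω (π X) := by
    intro X
    induction X using prod_matrix_induction with
    | hadd X Y hX hY => rw [Matrix.mul_add, trace_add, hX, hY, map_add, map_add]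
    | hzero => simp
    | hk a b =>
      rw [hk, hprod, hπ₁, hπ₂, Finset.sum_mul_sum, ← Fintype.sum_prod_type']
      simp only [trace, diag_apply, diagonal_mul, p]
      refine Finset.sum_congr rfl fun s _ => ?_
      have e : (a ⊗ₖ b) s s = a s.1 s.1 * b s.2 s.2 := rfl
      rw [e]
      push_cast
      ring
  have hDnn : ∀ s, 0 ≤ D s s := by
    intro s
    have e : D s s = φ (π (single s s 1)) := rfl
    have e2 : single s s (1 : ℂ) = star (single s s (1 : ℂ)) * single s s 1 := by
      rw [star_eq_conjTranspose, conjTranspose_single, single_mul_single_same]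
      simp
    rw [e, e2, map_mul, map_star]
    exact hφ.nonneg _
  have hDs : ∀ i j, D (i, j) (i, j) = φ (π₁ (single i i 1) * π₂ (single j j 1)) := by
    intro i j
    rw [← hk, single_kronecker_single, mul_one]
    rfl
  have hsum1 : ∀ i, ∑ j, (D (i, j) (i, j)).re = l i := by
    intro i
    have : ∑ j, D (i, j) (i, j) = l i := by
      simp only [hDs]
      rw [← map_sum, ← Finset.mul_sum, ← map_sum, sum_single_one, map_one, mul_one, hπ₁,
        Finset.sum_eq_single i (fun j _ hj => by simp [hj.symm]) (by simp)]
      simp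
    rw [← Complex.re_sum, this, Complex.ofReal_re]
  have hsum2 : ∀ j, ∑ i, (D (i, j) (i, j)).re = q j := by
    intro j
    have : ∑ i, D (i, j) (i, j) = q j := by
      simp only [hDs]
      rw [← map_sum, ← Finset.sum_mul, ← map_sum, sum_single_one, map_one, one_mul, hπ₂,
        Finset.sum_eq_single j (fun i _ hj => by simp [hj.symm]) (by simp)]
      simp
    rw [← Complex.re_sum, this, Complex.ofReal_re]
  have hre0 : ∀ s, 0 ≤ (D s s).re := fun s => (Complex.le_def.1 (hDnn s)).1
  -- A vanishing marginal weight kills the joint diagonal entries above it. This is the support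
  -- condition for a finite relative entropy, and it makes the convention `Real.log 0 = 0` harmless.
  have hz1 : ∀ i j, l i = 0 → (D (i, j) (i, j)).re = 0 := fun i j hi =>
    (Finset.sum_eq_zero_iff_of_nonneg fun j _ => hre0 (i, j)).1 ((hsum1 i).trans hi) j
      (Finset.mem_univ j)
  have hz2 : ∀ i j, q j = 0 → (D (i, j) (i, j)).re = 0 := fun i j hj =>
    (Finset.sum_eq_zero_iff_of_nonneg fun i _ => hre0 (i, j)).1 ((hsum2 j).trans hj) i
      (Finset.mem_univ i)
  have hYY : ∀ ψ : StrongDual ℂ 𝒜, IsState ψ → (ψ (π (Y * Y))).re ≤ 1 := by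
    intro ψ hψ
    have hs : π (Y * Y) = star (π Y) * π Y := by
      rw [map_mul, ← map_star, star_eq_conjTranspose, hY.eq]
    rw [hs]
    exact (hψ.re_star_mul_self_le _).trans (pow_le_one₀ (norm_nonneg _) hY1)
  have hmain := sq_trace_sub_le (D := D) (Y := Y) (q := p) hU hU' hspec hr0 hr1
    (fun s => mul_nonneg (hl0 _) (hq0 _))
    (by
      rw [Fintype.sum_prod_type]
      simp only [p, ← Finset.mul_sum, hq1, mul_one, hl1])
    (by
      rintro ⟨i, j⟩ hs
      apply Complex.ext
      · rcases mul_eq_zero.1 hs with h1 | h1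
        · simpa using hz1 i j h1
        · simpa using hz2 i j h1
      · exact (Complex.le_def.1 (hDnn (i, j))).2.symm)
    hY (by rw [hDtr]; exact hYY φ hφ) (by rw [hωtr]; exact hYY ω hω)
  rw [hωtr, hDtr] at hmain
  refine hmain.trans_eq ?_
  -- The logarithm of the product density splits, and summing out either index leaves a marginal
  -- entropy. The relative entropy thus becomes the mutual entropy.
  have hlog : ∑ s, (D s s).re * Real.log (p s) =
      ∑ i, l i * Real.log (l i) + ∑ j, q j * Real.log (q j) := by
    have e : ∀ i j, (D (i, j) (i, j)).re * Real.log (l i * q j) =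
        (D (i, j) (i, j)).re * Real.log (l i) + (D (i, j) (i, j)).re * Real.log (q j) := by
      intro i j
      by_cases h1 : l i = 0
      · simp [hz1 i j h1]
      by_cases h2 : q j = 0
      · simp [hz2 i j h2]
      rw [Real.log_mul h1 h2, mul_add]
    rw [Fintype.sum_prod_type]
    simp only [p, e, Finset.sum_add_distrib]
    congr 1
    · simp only [← Finset.sum_mul, hsum1]
    · rw [Finset.sum_comm]
      simp only [← Finset.sum_mul, hsum2]
  rw [hlog, hS]
  ring

/-- The entropic bound on the distance of a state to a product state. -/
theorem sq_norm_sub_le (hφ : IsState φ) (hω : IsState ω) (π₁ : Matrix ι ι ℂ →⋆ₐ[ℂ] 𝒜)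
    (π₂ : Matrix κ κ ℂ →⋆ₐ[ℂ] 𝒜) (h : ∀ a b, Commute (π₁ a) (π₂ b)) {l : ι → ℝ} {q : κ → ℝ}
    (hl0 : ∀ i, 0 ≤ l i) (hq0 : ∀ i, 0 ≤ q i) (hl1 : ∑ i, l i = 1) (hq1 : ∑ i, q i = 1)
    (hπ₁ : ∀ X, φ (π₁ X) = ∑ i, (l i : ℂ) * X i i) (hπ₂ : ∀ X, φ (π₂ X) = ∑ i, (q i : ℂ) * X i i)
    (hprod : ∀ a b, ω (π₁ a * π₂ b) = φ (π₁ a) * φ (π₂ b)) {C : ℝ}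
    (hC : -(∑ i, l i * Real.log (l i)) - ∑ j, q j * Real.log (q j) -
        vonNeumannEntropy (prodRep π₁ π₂ h).range φ ≤ C) {x : 𝒜}
    (hx : x ∈ (prodRep π₁ π₂ h).range) : ‖ω x - φ x‖ ^ 2 ≤ 2 * C * ‖x‖ ^ 2 := by
  obtain ⟨X, rfl⟩ := hx
  change ‖ω (prodRep π₁ π₂ h X) - φ (prodRep π₁ π₂ h X)‖ ^ 2 ≤
    2 * C * ‖prodRep π₁ π₂ h X‖ ^ 2
  set π := prodRep π₁ π₂ h
  have hsa : ∀ Y : Matrix (ι × κ) (ι × κ) ℂ, Y.IsHermitian → ‖π Y‖ ≤ 1 →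
      ((ω (π Y)).re - (φ (π Y)).re) ^ 2 ≤ 2 * C := fun Y hY hY1 =>
    (sq_re_sub_le hφ hω π₁ π₂ h hl0 hq0 hl1 hq1 hπ₁ hπ₂ hprod hY hY1).trans (by linarith)
  set z := ω (π X) - φ (π X) with hz
  rcases eq_or_ne z 0 with hz0 | hz0
  -- The sign of `C` is not assumed; it follows from the estimate at the zero matrix.
  · have hC0 : 0 ≤ 2 * C := by simpa using hsa 0 isHermitian_zero (by simp)
    rw [hz0, norm_zero, zero_pow two_ne_zero]
    exact mul_nonneg hC0 (sq_nonneg _)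
  have hx0 : 0 < ‖π X‖ := by
    rw [norm_pos_iff]
    rintro hx
    simp [hz, hx] at hz0
  have hz0' : 0 < ‖z‖ := norm_pos_iff.2 hz0
  -- The scalar `c` normalizes `π X` and rotates `z` to a positive number. The self-adjoint part of
  -- `c • π X` then already sees all of `‖z‖`, so passing from self-adjoint to general elements
  -- costs no factor.
  let c : ℂ := star z / ((‖z‖ * ‖π X‖ : ℝ) : ℂ)
  have hcn : ‖c‖ = ‖π X‖⁻¹ := by
    simp only [c, norm_div, norm_star, Complex.norm_real, Real.norm_eq_abs]
    rw [abs_of_pos (by positivity)]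
    field_simp
  have hcz : c * z = ((‖z‖ / ‖π X‖ : ℝ) : ℂ) := by
    have : star z * z = ((‖z‖ ^ 2 : ℝ) : ℂ) := by
      rw [RCLike.star_def, RCLike.conj_mul]; simp
    have h1 : (‖z‖ : ℂ) ≠ 0 := by exact_mod_cast hz0'.ne'
    have h2 : (‖π X‖ : ℂ) ≠ 0 := by exact_mod_cast hx0.ne'
    simp only [c]
    rw [div_mul_eq_mul_div, this]
    push_cast
    field_simp
  let Y : Matrix (ι × κ) (ι × κ) ℂ := (1 / 2 : ℂ) • (c • X + (c • X)ᴴ)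
  have hY : Y.IsHermitian := by
    have : Yᴴ = Y := by
      simp [Y, conjTranspose_smul, conjTranspose_add, add_comm]
    exact this
  have hπY : π Y = (1 / 2 : ℂ) • (c • π X + star (c • π X)) := by
    simp only [Y, map_smul, map_add, ← star_eq_conjTranspose, map_star]
  have hY1 : ‖π Y‖ ≤ 1 := by
    have h1 : ‖c • π X‖ = 1 := by rw [norm_smul, hcn]; field_simp
    rw [hπY, norm_smul]
    have h2 := norm_add_le (c • π X) (star (c • π X))
    rw [norm_star, h1] at h2
    have h3 : ‖(1 / 2 : ℂ)‖ = 1 / 2 := by norm_num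
    rw [h3]
    linarith
  have hval : ∀ ψ : StrongDual ℂ 𝒜, IsState ψ → (ψ (π Y)).re = (c * ψ (π X)).re := by
    intro ψ hψ
    have e : ψ (π Y) = (1 / 2 : ℂ) * (c * ψ (π X) + star (c * ψ (π X))) := by
      rw [hπY, map_smul, map_add, hψ.map_star, map_smul, smul_eq_mul, smul_eq_mul]
    rw [e, RCLike.star_def, Complex.add_conj]
    simp
  have hfin := hsa Y hY hY1
  rw [hval ω hω, hval φ hφ, ← Complex.sub_re, ← mul_sub, ← hz, hcz, Complex.ofReal_re, div_pow,
    div_le_iff₀ (by positivity)] at hfin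
  exact hfin

end Products

/-! ### Passage to the whole lattice -/

section Global

variable {Γ 𝒜 : Type*} [CStarAlgebra 𝒜] {φ : StrongDual ℂ 𝒜}

-- The infimum lies below each of its terms, so the area law bounds every finite-volume mutual
-- entropy with the same constant.
open Classical in
theorem entropy_le_of_mutualEntropy_le {alg : Finset Γ → StarSubalgebra ℂ 𝒜} {I : Finset Γ}
    {J : Set Γ} {C : ℝ} (h : mutualEntropy alg φ I J ≤ (C : EReal)) {L : Finset Γ}
    (hL : (L : Set Γ) ⊆ J) :
    vonNeumannEntropy (alg I) φ + vonNeumannEntropy (alg L) φ -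
      vonNeumannEntropy (alg (I ∪ L)) φ ≤ C := by
  have h1 : conditionalEntropy alg φ I J ≤
      ((vonNeumannEntropy (alg (I ∪ L)) φ - vonNeumannEntropy (alg L) φ : ℝ) : EReal) :=
    iInf_le (fun L : {L : Finset Γ // (L : Set Γ) ⊆ J} =>
      ((vonNeumannEntropy (alg (I ∪ L.1)) φ - vonNeumannEntropy (alg L.1) φ : ℝ) : EReal)) ⟨L, hL⟩
  have h2 := (EReal.sub_le_sub le_rfl h1).trans h
  rw [← EReal.coe_sub, EReal.coe_le_coe_iff] at h2
  linarith

theorem regionAlgebra_le {alg : Finset Γ → StarSubalgebra ℂ 𝒜} {J : Set Γ}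
    {S : StarSubalgebra ℂ 𝒜} (hS : IsClosed (S : Set 𝒜))
    (h : ∀ I : Finset Γ, (I : Set Γ) ⊆ J → alg I ≤ S) : regionAlgebra alg J ≤ S :=
  StarSubalgebra.topologicalClosure_minimal (iSup_le fun I => h I.1 I.2) hS

theorem le_regionAlgebra (alg : Finset Γ → StarSubalgebra ℂ 𝒜) {J : Set Γ} {I : Finset Γ}
    (h : (I : Set Γ) ⊆ J) : alg I ≤ regionAlgebra alg J :=
  (le_iSup (fun I : {I : Finset Γ // (I : Set Γ) ⊆ J} => alg I.1) ⟨I, h⟩).trans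
    (StarSubalgebra.le_topologicalClosure _)

theorem isClosed_centralizer (s : Set 𝒜) :
    IsClosed (StarSubalgebra.centralizer ℂ s : Set 𝒜) := by
  rw [StarSubalgebra.coe_centralizer]
  exact Set.isClosed_centralizer _

/-- The area-law estimates follow from the estimates on the local algebras. -/
theorem area_law_of_local {alg : Finset Γ → StarSubalgebra ℂ 𝒜} {A : Finset Γ}
    (hdense : Dense (⋃ I, (alg I : Set 𝒜))) (hex : ∃ ω, IsProductState alg φ A ω)
    (huniq : ∀ ω ω', IsProductState alg φ A ω → IsProductState alg φ A ω' →
      ∀ I, ∀ x ∈ alg I, ω x = ω' x) {s : ℝ} (hs : 0 ≤ s)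
    (hloc : ∀ ω, IsProductState alg φ A ω → ∀ I, ∀ x ∈ alg I,
      ‖ω x - φ x‖ ^ 2 ≤ 2 * (2 * s) * ‖x‖ ^ 2) :
    (∃! ω, IsProductState alg φ A ω) ∧
    (∀ ω, IsProductState alg φ A ω → ‖ω - φ‖ ^ 2 ≤ 4 * s) ∧
    (∀ a ∈ alg A, ∀ b ∈ regionAlgebra alg (A : Set Γ)ᶜ, ‖a‖ ≤ 1 → ‖b‖ ≤ 1 →
      ‖φ (a * b) - φ a * φ b‖ ≤ 2 * s ^ (1 / 2 : ℝ)) := by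
  have hnorm : ∀ ω, IsProductState alg φ A ω → ‖ω - φ‖ ≤ √(4 * s) := by
    intro ω hω
    refine ContinuousLinearMap.opNorm_le_bound _ (Real.sqrt_nonneg _) fun x => ?_
    refine hdense.induction (P := fun x => ‖(ω - φ) x‖ ≤ √(4 * s) * ‖x‖) ?_
      (isClosed_le (by fun_prop) (by fun_prop)) x
    intro y hy
    obtain ⟨I, hI⟩ := Set.mem_iUnion.1 hy
    refine le_of_sq_le_sq ?_ (by positivity)
    rw [mul_pow, Real.sq_sqrt (by positivity)]
    refine (hloc ω hω I y hI).trans_eq ?_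
    ring
  obtain ⟨ω, hω⟩ := hex
  refine ⟨⟨ω, hω, fun ω' hω' => ?_⟩, fun ω hω => ?_, fun a ha b hb ha1 hb1 => ?_⟩
  · refine ContinuousLinearMap.coeFn_injective
      (Continuous.ext_on hdense ω'.continuous ω.continuous ?_)
    intro y hy
    obtain ⟨I, hI⟩ := Set.mem_iUnion.1 hy
    exact huniq ω' ω hω' hω I y hI
  · have := pow_le_pow_left₀ (norm_nonneg _) (hnorm ω hω) 2
    rwa [Real.sq_sqrt (by positivity)] at this
  · have h1 : φ (a * b) - φ a * φ b = -((ω - φ) (a * b)) := by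
      rw [sub_apply, hω.map_mul a ha b hb]
      ring
    have h2 : ‖a * b‖ ≤ 1 := (norm_mul_le _ _).trans (mul_le_one₀ ha1 (norm_nonneg _) hb1)
    rw [h1, norm_neg]
    calc ‖(ω - φ) (a * b)‖ ≤ ‖ω - φ‖ * ‖a * b‖ := ContinuousLinearMap.le_opNorm _ _
      _ ≤ ‖ω - φ‖ := mul_le_of_le_one_right (norm_nonneg _) h2
      _ ≤ √(4 * s) := hnorm ω hω
      _ = 2 * s ^ (1 / 2 : ℝ) := by
        rw [Real.sqrt_mul (by norm_num), Real.sqrt_eq_rpow s]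
        congr 1
        rw [show (4 : ℝ) = 2 ^ 2 by norm_num]
        exact Real.sqrt_sq (by norm_num)

end Global

/-! ### Spin systems -/

section SpinAreaLaw

variable {Γ 𝒜 : Type*} [CStarAlgebra 𝒜] {φ : StrongDual ℂ 𝒜}

namespace SpinSystem

theorem exists_rep (S : SpinSystem Γ 𝒜) (I : Finset Γ) :
    ∃ (k : ℕ) (π : Matrix (Fin k) (Fin k) ℂ →⋆ₐ[ℂ] 𝒜), π.range = S.alg I := by
  obtain ⟨k, ⟨e⟩⟩ := S.matrix I
  refine ⟨k, (S.alg I).subtype.comp (e.symm : _ →⋆ₐ[ℂ] S.alg I), ?_⟩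
  ext x
  constructor
  · rintro ⟨X, rfl⟩
    exact (e.symm X).2
  · intro hx
    exact ⟨e ⟨x, hx⟩, congrArg Subtype.val (e.symm_apply_apply ⟨x, hx⟩)⟩

open Classical in
theorem alg_union (S : SpinSystem Γ 𝒜) {I J : Finset Γ} (h : Disjoint I J) :
    S.alg (I ∪ J) = S.alg I ⊔ S.alg J := by
  have hr := S.mulMap_range I J h
  rw [Submodule.mulMap_range] at hr
  have hmem : ∀ x, x ∈ S.alg (I ∪ J) ↔ x ∈ Subalgebra.toSubmodule (S.alg I).toSubalgebra *
      Subalgebra.toSubmodule (S.alg J).toSubalgebra := fun x => by rw [hr]; rfl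
  apply le_antisymm
  · intro x hx
    rw [hmem] at hx
    have : Subalgebra.toSubmodule (S.alg I).toSubalgebra *
      Subalgebra.toSubmodule (S.alg J).toSubalgebra ≤
        Subalgebra.toSubmodule (S.alg I ⊔ S.alg J).toSubalgebra :=
      Submodule.mul_le.2 fun a ha b hb => mul_mem (S := StarSubalgebra ℂ 𝒜)
        (s := S.alg I ⊔ S.alg J)
        ((le_sup_left : S.alg I ≤ S.alg I ⊔ S.alg J) ha)
        ((le_sup_right : S.alg J ≤ S.alg I ⊔ S.alg J) hb)
    exact this hx
  · refine sup_le (fun x hx => ?_) (fun x hx => ?_)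
    · rw [hmem, ← mul_one x]
      exact Submodule.mul_mem_mul hx (one_mem (S.alg J))
    · rw [hmem, ← one_mul x]
      exact Submodule.mul_mem_mul (one_mem (S.alg I)) hx

/-- The local algebra of `I` lies in the algebra generated by the commuting matrix algebras of `A`
and `I \ A`. Both are taken in matrix units diagonalizing `φ`, so the estimate for product
representations applies. -/
theorem area_law (S : SpinSystem Γ 𝒜) (hφ : IsState φ) (A : Finset Γ) {s : ℝ} (hs : 0 ≤ s)
    (h : mutualEntropy S.alg φ A (A : Set Γ)ᶜ ≤ ((2 * s : ℝ) : EReal)) :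
    (∃! ω, IsProductState S.alg φ A ω) ∧
    (∀ ω, IsProductState S.alg φ A ω → ‖ω - φ‖ ^ 2 ≤ 4 * s) ∧
    (∀ a ∈ S.alg A, ∀ b ∈ regionAlgebra S.alg (A : Set Γ)ᶜ, ‖a‖ ≤ 1 → ‖b‖ ≤ 1 →
      ‖φ (a * b) - φ a * φ b‖ ≤ 2 * s ^ (1 / 2 : ℝ)) := by
  classical
  obtain ⟨n, π, hπ⟩ := S.exists_rep A
  obtain ⟨π₁, l, hr₁, hl0, hl1, hπ₁, hS₁⟩ := exists_diagonal_rep hφ π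
  rw [hπ] at hr₁ hS₁
  have hmem₁ : ∀ X, π₁ X ∈ S.alg A := fun X => hr₁ ▸ ⟨X, rfl⟩
  have hcomm : ∀ a ∈ S.alg A, ∀ b ∈ regionAlgebra S.alg (A : Set Γ)ᶜ, Commute a b := by
    intro a ha b hb
    -- Centralizers are closed, so commutation passes from the local algebras to the infinite
    -- region.
    have hle : regionAlgebra S.alg (A : Set Γ)ᶜ ≤ StarSubalgebra.centralizer ℂ {a} := by
      refine regionAlgebra_le (isClosed_centralizer _) fun I hI x hx => ?_
      rw [StarSubalgebra.mem_centralizer_iff]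
      have hd : Disjoint A I := Finset.disjoint_left.2 fun i hi hi' => hI hi' hi
      rintro _ rfl
      exact ⟨S.commute A I hd _ ha x hx, S.commute A I hd _ (star_mem ha) x hx⟩
    exact ((StarSubalgebra.mem_centralizer_iff ℂ).1 (hle hb) a rfl).1
  have hlocal : ∀ I, ∃ (m : ℕ) (π₂ : Matrix (Fin m) (Fin m) ℂ →⋆ₐ[ℂ] 𝒜) (q : Fin m → ℝ)
      (hc : ∀ a b, Commute (π₁ a) (π₂ b)), (∀ i, 0 ≤ q i) ∧ ∑ i, q i = 1 ∧
      (∀ X, φ (π₂ X) = ∑ i, (q i : ℂ) * X i i) ∧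
      (∀ b, π₂ b ∈ regionAlgebra S.alg (A : Set Γ)ᶜ) ∧
      S.alg I ≤ (prodRep π₁ π₂ hc).range ∧
      -(∑ i, l i * Real.log (l i)) - ∑ j, q j * Real.log (q j) -
        vonNeumannEntropy (prodRep π₁ π₂ hc).range φ ≤ 2 * s := by
    intro I
    set L := I \ A
    have hL : (L : Set Γ) ⊆ (A : Set Γ)ᶜ := fun i hi => (Finset.mem_sdiff.1 hi).2
    have hd : Disjoint A L := Finset.disjoint_sdiff
    obtain ⟨m, π', hπ'⟩ := S.exists_rep L
    obtain ⟨π₂, q, hr₂, hq0, hq1, hπ₂, hS₂⟩ := exists_diagonal_rep hφ π'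
    rw [hπ'] at hr₂ hS₂
    have hmem₂ : ∀ X, π₂ X ∈ S.alg L := fun X => hr₂ ▸ ⟨X, rfl⟩
    have hc : ∀ a b, Commute (π₁ a) (π₂ b) := fun a b =>
      S.commute A L hd _ (hmem₁ a) _ (hmem₂ b)
    have hrange : (prodRep π₁ π₂ hc).range = S.alg (A ∪ L) := by
      rw [prodRep_range, hr₁, hr₂, S.alg_union hd]
    refine ⟨m, π₂, q, hc, hq0, hq1, hπ₂, fun b => le_regionAlgebra _ hL (hmem₂ b), ?_, ?_⟩
    · rw [hrange]
      -- Monotonicity of the local algebras is obtained from the factorization over a disjoint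
      -- union.
      have e : A ∪ L = I ∪ (A \ I) := by
        ext i; simp only [L, Finset.mem_union, Finset.mem_sdiff]; tauto
      rw [e, S.alg_union Finset.disjoint_sdiff]
      exact le_sup_left
    · have hent := entropy_le_of_mutualEntropy_le h hL
      have e : vonNeumannEntropy (prodRep π₁ π₂ hc).range φ =
        vonNeumannEntropy (S.alg (A ∪ L)) φ := by rw [hrange]
      rw [e]
      rw [hS₁, hS₂] at hent
      linarith
  obtain ⟨ω₀, hω₀, hω₀mul⟩ := exists_state_mul_of_commute hφ π₁ hl0 hπ₁
  refine area_law_of_local S.dense ⟨ω₀, hω₀, fun a ha b hb => ?_⟩ ?_ hs ?_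
  · rw [← hr₁] at ha
    obtain ⟨X, rfl⟩ := ha
    exact hω₀mul X b fun Y => hcomm _ (hmem₁ Y) b hb
  · intro ω ω' hω hω' I x hx
    obtain ⟨m, π₂, q, hc, -, -, -, hmem₂, hle, -⟩ := hlocal I
    obtain ⟨X, rfl⟩ := hle hx
    refine eq_on_prodRep π₁ π₂ hc (fun a b => ?_) X
    rw [hω.map_mul _ (hmem₁ a) _ (hmem₂ b), hω'.map_mul _ (hmem₁ a) _ (hmem₂ b)]
  · intro ω hω I x hx
    obtain ⟨m, π₂, q, hc, hq0, hq1, hπ₂, hmem₂, hle, hent⟩ := hlocal I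
    exact sq_norm_sub_le hφ hω.isState π₁ π₂ hc hl0 hq0 hl1 hq1 hπ₁ hπ₂
      (fun a b => hω.map_mul _ (hmem₁ a) _ (hmem₂ b)) hent (hle hx)

end SpinSystem

end SpinAreaLaw

/-! ### Fermion systems -/

section FermionAreaLaw

variable {Γ 𝒜 : Type*} [CStarAlgebra 𝒜]

/-- The two-dimensional matrix representation generated by one fermionic mode. -/
noncomputable def modeRep (c : 𝒜) (hcc : c * c = 0) (hc : c * star c + star c * c = 1) :
    Matrix (Fin 2) (Fin 2) ℂ →⋆ₐ[ℂ] 𝒜 :=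
  have hss : star c * star c = 0 := by rw [← star_mul, hcc, star_zero]
  have h1 : c * star c * c = c := by
    rw [eq_sub_of_add_eq hc, sub_mul, mul_assoc, hcc, mul_zero, one_mul, sub_zero]
  have h2 : star c * c * star c = star c := by
    rw [eq_sub_of_add_eq' hc, sub_mul, mul_assoc, hss, mul_zero, one_mul, sub_zero]
  -- Index `0` is the occupied level and index `1` the empty one, so `c` is the matrix unit at `(1,
  -- 0)`.
  { toFun := fun X => X 0 0 • (star c * c) + X 0 1 • star c + X 1 0 • c + X 1 1 • (c * star c)
    map_one' := by simp [add_comm (star c * c), hc]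
    map_zero' := by simp
    map_add' := fun X Y => by simp only [Matrix.add_apply]; module
    commutes' := fun r => by
      simp only [Matrix.algebraMap_eq_diagonal, Algebra.algebraMap_eq_smul_one (A := 𝒜), ← hc]
      simp
      module
    map_star' := fun X => by
      simp
      abel
    map_mul' := fun X Y => by
      have e1 : star c * c * (star c * c) = star c * c := by rw [← mul_assoc, h2]
      have e2 : star c * c * c = 0 := by rw [mul_assoc, hcc, mul_zero]
      have e3 : star c * c * (c * star c) = 0 := by rw [← mul_assoc, e2, zero_mul]
      have e4 : star c * (star c * c) = 0 := by rw [← mul_assoc, hss, zero_mul]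
      have e5 : star c * (c * star c) = star c := by rw [← mul_assoc, h2]
      have e6 : c * (star c * c) = c := by rw [← mul_assoc, h1]
      have e7 : c * (c * star c) = 0 := by rw [← mul_assoc, hcc, zero_mul]
      have e8 : c * star c * (star c * c) = 0 := by rw [mul_assoc, e4, mul_zero]
      have e9 : c * star c * star c = 0 := by rw [mul_assoc, hss, mul_zero]
      have e10 : c * star c * (c * star c) = c * star c := by rw [← mul_assoc, h1]
      simp only [Matrix.mul_apply, Fin.sum_univ_two, add_mul, mul_add, smul_mul_smul_comm, e1, e2,
        e3, e4, e5, e6, e7, e8, e9, e10, h1, h2, hss, hcc, smul_zero]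
      module }

theorem modeRep_apply (c : 𝒜) (hcc : c * c = 0) (hc : c * star c + star c * c = 1)
    (X : Matrix (Fin 2) (Fin 2) ℂ) : modeRep c hcc hc X =
      X 0 0 • (star c * c) + X 0 1 • star c + X 1 0 • c + X 1 1 • (c * star c) := rfl

theorem modeRep_range (c : 𝒜) (hcc : c * c = 0) (hc : c * star c + star c * c = 1) :
    (modeRep c hcc hc).range = StarAlgebra.adjoin ℂ {c} := by
  have hmem : c ∈ StarAlgebra.adjoin ℂ {c} := StarAlgebra.subset_adjoin ℂ _ rfl
  apply le_antisymm
  · rintro _ ⟨X, rfl⟩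
    change modeRep c hcc hc X ∈ _
    rw [modeRep_apply]
    have hs := star_mem hmem
    exact add_mem (add_mem (add_mem (SMulMemClass.smul_mem _ (mul_mem hs hmem))
      (SMulMemClass.smul_mem _ hs)) (SMulMemClass.smul_mem _ hmem))
      (SMulMemClass.smul_mem _ (mul_mem hmem hs))
  · refine StarAlgebra.adjoin_le ?_
    rintro _ rfl
    exact ⟨Matrix.single 1 0 1, (modeRep_apply _ hcc hc _).trans (by simp)⟩

namespace FermionSystem

variable (F : FermionSystem Γ 𝒜)

theorem c_mul_c (i j : Γ) : F.c i * F.c j = -(F.c j * F.c i) :=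
  eq_neg_of_add_eq_zero_left (F.anticomm i j)

theorem star_c_mul_c {i j : Γ} (h : i ≠ j) : star (F.c i) * F.c j = -(F.c j * star (F.c i)) := by
  have h' := F.star_anticomm i j
  rw [if_neg h] at h'
  exact eq_neg_of_add_eq_zero_left h'

theorem c_sq (i : Γ) : F.c i * F.c i = 0 := by
  have h := F.anticomm i i
  rw [← two_smul ℂ] at h
  simpa using h

theorem c_mul_star_c (i : Γ) : F.c i * star (F.c i) + star (F.c i) * F.c i = 1 := by
  have h := F.star_anticomm i i
  rwa [if_pos rfl, add_comm] at h

theorem c_mem_alg {I : Finset Γ} {i : Γ} (h : i ∈ I) : F.c i ∈ F.alg I :=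
  StarAlgebra.subset_adjoin ℂ _ ⟨i, h, rfl⟩

theorem alg_le {I : Finset Γ} {S : StarSubalgebra ℂ 𝒜} (h : ∀ i ∈ I, F.c i ∈ S) : F.alg I ≤ S :=
  StarAlgebra.adjoin_le (by rintro _ ⟨i, hi, rfl⟩; exact h i hi)

theorem grading_grading (x : 𝒜) : F.grading (F.grading x) = x := by
  have h : (F.grading : 𝒜 →⋆ₐ[ℂ] 𝒜).comp (F.grading : 𝒜 →⋆ₐ[ℂ] 𝒜) = StarAlgHom.id ℂ 𝒜 :=
    F.ext_hom fun i => by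
      change F.grading (F.grading (F.c i)) = F.c i
      rw [F.grading_c, map_neg, F.grading_c, neg_neg]
  exact DFunLike.congr_fun h x

open scoped CStarAlgebra in
theorem continuous_grading : Continuous F.grading :=
  map_continuous (F.grading : 𝒜 →⋆ₐ[ℂ] 𝒜)

theorem grading_mem_alg {I : Finset Γ} {x : 𝒜} (hx : x ∈ F.alg I) : F.grading x ∈ F.alg I := by
  have : F.alg I ≤ (F.alg I).comap (F.grading : 𝒜 →⋆ₐ[ℂ] 𝒜) := F.alg_le fun i hi => by
    change F.grading (F.c i) ∈ F.alg I
    rw [F.grading_c]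
    exact neg_mem (F.c_mem_alg hi)
  exact this hx

theorem grading_mem_regionAlgebra {J : Set Γ} {x : 𝒜} (hx : x ∈ regionAlgebra F.alg J) :
    F.grading x ∈ regionAlgebra F.alg J := by
  have : regionAlgebra F.alg J ≤ (regionAlgebra F.alg J).comap (F.grading : 𝒜 →⋆ₐ[ℂ] 𝒜) :=
    regionAlgebra_le ((StarSubalgebra.isClosed_topologicalClosure _).preimage F.continuous_grading)
      fun I hI y hy => le_regionAlgebra _ hI (F.grading_mem_alg hy)
  exact this hx

/-! ### Parity operators and matrix structure of finite fermion regions. -/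

/-- `v` is the self-adjoint unitary of the region `I` implementing the grading on `I`. -/
structure IsParity (I : Finset Γ) (v : 𝒜) : Prop where
  mem : v ∈ F.alg I
  star_eq : star v = v
  sq : v * v = 1
  anticomm : ∀ i ∈ I, v * F.c i = -(F.c i * v)
  comm : ∀ i ∉ I, v * F.c i = F.c i * v
  grading_eq : F.grading v = v

/-- The parity operator is the product over the modes of the commuting self-adjoint unitaries `1 - 2
cᵢ⋆cᵢ`. Each of them anticommutes with its own mode and commutes with all others. -/
theorem exists_isParity (I : Finset Γ) : ∃ v, F.IsParity I v := by
  classical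
  induction I using Finset.induction_on with
  | empty => exact ⟨1, one_mem _, star_one _, one_mul _, by simp, by simp, map_one _⟩
  | insert i I hi ih =>
    obtain ⟨v, hv⟩ := ih
    have cc := F.c_sq i
    have sc : F.c i * star (F.c i) = 1 - star (F.c i) * F.c i :=
      eq_sub_of_add_eq (F.c_mul_star_c i)
    set n : 𝒜 := star (F.c i) * F.c i with hn
    have nc : n * F.c i = 0 := by rw [hn, mul_assoc, cc, mul_zero]
    have cn : F.c i * n = F.c i := by
      rw [hn, ← mul_assoc, sc, sub_mul, nc, one_mul, sub_zero]
    have nn : n * n = n := by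
      nth_rewrite 1 [hn]
      rw [mul_assoc, cn]
    have sn : star n = n := by simp [hn]
    have nj : ∀ j, j ≠ i → n * F.c j = F.c j * n := by
      intro j hj
      rw [hn, mul_assoc, F.c_mul_c i j, mul_neg, ← mul_assoc, F.star_c_mul_c hj.symm, neg_mul,
        neg_neg, mul_assoc]
    have vs : v * star (F.c i) = star (F.c i) * v := by
      have := congrArg star (hv.comm i hi)
      rw [star_mul, star_mul, hv.star_eq] at this
      exact this.symm
    have vn : v * n = n * v := by
      rw [hn, ← mul_assoc, vs, mul_assoc, hv.comm i hi, mul_assoc]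
    set u : 𝒜 := 1 - (n + n) with hu
    have su : star u = u := by simp [hu, sn]
    have uu : u * u = 1 := by
      simp only [hu, mul_sub, sub_mul, mul_add, add_mul, nn, mul_one, one_mul]
      abel
    have uc : u * F.c i = F.c i := by simp [hu, sub_mul, add_mul, nc]
    have cu : F.c i * u = -F.c i := by simp [hu, mul_sub, mul_add, cn]
    have uj : ∀ j, j ≠ i → u * F.c j = F.c j * u := fun j hj => by
      simp [hu, sub_mul, add_mul, mul_sub, mul_add, nj j hj]
    have vu : v * u = u * v := by
      simp [hu, sub_mul, add_mul, mul_sub, mul_add, vn]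
    have hci : F.c i ∈ F.alg (insert i I) := F.c_mem_alg (Finset.mem_insert_self i I)
    have hnm : n ∈ F.alg (insert i I) := mul_mem (star_mem hci) hci
    refine ⟨v * u, mul_mem (F.alg_mono (Finset.subset_insert i I) hv.mem)
      (sub_mem (one_mem _) (add_mem hnm hnm)), ?_, ?_, ?_, ?_, ?_⟩
    · rw [star_mul, su, hv.star_eq, vu]
    · rw [mul_assoc, ← mul_assoc u, ← vu, mul_assoc, uu, mul_one, hv.sq]
    · intro j hj
      rcases eq_or_ne j i with rfl | hne
      · rw [mul_assoc, uc, ← mul_assoc, ← hv.comm j hi, mul_assoc, cu, mul_neg, neg_neg]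
      · rw [mul_assoc, uj j hne, ← mul_assoc,
          hv.anticomm j ((Finset.mem_insert.1 hj).resolve_left hne), neg_mul, mul_assoc]
    · intro j hj
      rw [Finset.mem_insert, not_or] at hj
      rw [mul_assoc, uj j hj.1, ← mul_assoc, hv.comm j hj.2, mul_assoc]
    · have gn : F.grading n = n := by
        rw [hn, map_mul, map_star, F.grading_c, star_neg, neg_mul_neg]
      rw [map_mul, hv.grading_eq, hu, map_sub, map_one, map_add, gn]

section Parity

variable {F} {A : Finset Γ} {v : 𝒜}

theorem IsParity.comm_star (hv : F.IsParity A v) {i : Γ} (hi : i ∉ A) : v * star (F.c i) = star (F.c i) * v := by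
  have := congrArg star (hv.comm i hi)
  rw [star_mul, star_mul, hv.star_eq] at this
  exact this.symm

/-- The Klein transform of a mode outside a region commutes with the algebra of the region. -/
theorem IsParity.commute_mul_c (hv : F.IsParity A v) {i : Γ} (hi : i ∉ A) {a : 𝒜} (ha : a ∈ F.alg A) :
    Commute a (v * F.c i) := by
  have h : F.alg A ≤ StarSubalgebra.centralizer ℂ {v * F.c i} := F.alg_le fun j hj => by
    have hne : i ≠ j := fun h => hi (h ▸ hj)
    rw [StarSubalgebra.mem_centralizer_iff]
    rintro _ rfl
    constructor
    · rw [mul_assoc, F.c_mul_c i j, mul_neg, ← mul_assoc, hv.anticomm j hj, neg_mul, neg_neg,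
        mul_assoc]
    · rw [star_mul, hv.star_eq, mul_assoc, hv.anticomm j hj, mul_neg, ← mul_assoc,
        F.star_c_mul_c hne, neg_mul, neg_neg, mul_assoc]
  exact (((StarSubalgebra.mem_centralizer_iff ℂ).1 (h ha) _ rfl).1).symm

theorem IsParity.c_eq (hv : F.IsParity A v) {i : Γ} : F.c i = v * (v * F.c i) := by
  rw [← mul_assoc, hv.sq, one_mul]

theorem IsParity.modeRep_sq (hv : F.IsParity A v) {i : Γ} (hi : i ∉ A) : (v * F.c i) * (v * F.c i) = 0 := by
  nth_rewrite 1 [hv.comm i hi]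
  rw [mul_assoc, ← mul_assoc v, hv.sq, one_mul, F.c_sq]

theorem IsParity.modeRep_anticomm (hv : F.IsParity A v) {i : Γ} (hi : i ∉ A) :
    (v * F.c i) * star (v * F.c i) + star (v * F.c i) * (v * F.c i) = 1 := by
  have e1 : (v * F.c i) * star (v * F.c i) = F.c i * star (F.c i) := by
    rw [star_mul, hv.star_eq, hv.comm i hi, mul_assoc, ← mul_assoc v, hv.comm_star hi, mul_assoc,
      hv.sq, mul_one]
  have e2 : star (v * F.c i) * (v * F.c i) = star (F.c i) * F.c i := by
    rw [star_mul, hv.star_eq, mul_assoc, ← mul_assoc v, hv.sq, one_mul]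
  rw [e1, e2, F.c_mul_star_c]

end Parity

/-- The algebra of a finite region is a full matrix algebra. -/
theorem exists_rep (I : Finset Γ) :
    ∃ (ι : Type) (_ : Fintype ι) (_ : DecidableEq ι) (π : Matrix ι ι ℂ →⋆ₐ[ℂ] 𝒜),
      π.range = F.alg I := by
  classical
  induction I using Finset.induction_on with
  | empty =>
    let π : Matrix Unit Unit ℂ →⋆ₐ[ℂ] 𝒜 :=
      { toFun := fun X => algebraMap ℂ 𝒜 (X () ())
        map_one' := by simp
        map_zero' := by simp
        map_add' := by simp
        map_mul' := by simp [Matrix.mul_apply]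
        commutes' := by simp [Matrix.algebraMap_eq_diagonal]
        map_star' := fun X => by
          rw [← algebraMap_star_comm]
          rfl }
    refine ⟨Unit, inferInstance, inferInstance, π, ?_⟩
    have e : F.alg ∅ = ⊥ := le_antisymm (F.alg_le (by simp)) bot_le
    rw [e]
    apply le_antisymm
    · rintro _ ⟨X, rfl⟩
      exact algebraMap_mem _ _
    · exact bot_le
  | insert i I hi ih =>
    obtain ⟨ι, _, _, π, hπ⟩ := ih
    obtain ⟨v, hv⟩ := F.exists_isParity I
    have hmem : ∀ a, π a ∈ F.alg I := fun a => hπ ▸ ⟨a, rfl⟩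
    -- This is the Jordan–Wigner step: the twisted mode `v * F.c i` generates a copy of the two by
    -- two matrices commuting with the algebra of `I`, and adding it doubles the matrix size.
    let ρ := modeRep (v * F.c i) (hv.modeRep_sq hi) (hv.modeRep_anticomm hi)
    have hρ : ρ.range = StarAlgebra.adjoin ℂ {v * F.c i} := modeRep_range _ _ _
    have hcomm : ∀ a b, Commute (π a) (ρ b) := by
      intro a b
      have hle : StarAlgebra.adjoin ℂ {v * F.c i} ≤ StarSubalgebra.centralizer ℂ {π a} := by
        refine StarAlgebra.adjoin_le ?_
        rintro _ rfl
        refine (StarSubalgebra.mem_centralizer_iff ℂ).2 ?_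
        rintro _ rfl
        exact ⟨hv.commute_mul_c hi (hmem a), hv.commute_mul_c hi (star_mem (hmem a))⟩
      have hb : ρ b ∈ StarAlgebra.adjoin ℂ {v * F.c i} := hρ ▸ ⟨b, rfl⟩
      exact ((StarSubalgebra.mem_centralizer_iff ℂ).1 (hle hb) _ rfl).1
    refine ⟨ι × Fin 2, inferInstance, inferInstance, prodRep π ρ hcomm, ?_⟩
    rw [prodRep_range, hπ, hρ]
    have hsub := F.alg_mono (Finset.subset_insert i I)
    apply le_antisymm
    · refine sup_le hsub (StarAlgebra.adjoin_le ?_)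
      rintro _ rfl
      exact mul_mem (hsub hv.mem) (F.c_mem_alg (Finset.mem_insert_self i I))
    · have h1 : F.alg I ≤ F.alg I ⊔ StarAlgebra.adjoin ℂ {v * F.c i} := le_sup_left
      have h2 : StarAlgebra.adjoin ℂ {v * F.c i} ≤
          F.alg I ⊔ StarAlgebra.adjoin ℂ {v * F.c i} := le_sup_right
      refine F.alg_le fun j hj => ?_
      rcases Finset.mem_insert.1 hj with rfl | hj
      · have h3 := mul_mem (h1 hv.mem) (h2 (StarAlgebra.subset_adjoin ℂ _ rfl))
        rwa [← hv.c_eq] at h3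
      · exact h1 (F.c_mem_alg hj)

end FermionSystem

end FermionAreaLaw

section FermionAreaLaw

variable {Γ 𝒜 : Type*} [CStarAlgebra 𝒜]

namespace FermionSystem

/-! ### The Klein transform -/

section Klein

variable (F : FermionSystem Γ 𝒜) (v : 𝒜)

/-- The Klein transform, multiplying the odd part of an element by the parity operator `v`. -/
noncomputable def klein (x : 𝒜) : 𝒜 :=
  (1 / 2 : ℂ) • (1 + v) * x + (1 / 2 : ℂ) • (1 - v) * F.grading x

variable {F v} {A : Finset Γ}

theorem proj_add :
    (1 / 2 : ℂ) • (1 + v) + (1 / 2 : ℂ) • (1 - v) = 1 := by module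

theorem IsParity.proj_mul_proj (hv : F.IsParity A v) :
    ((1 / 2 : ℂ) • (1 + v)) * ((1 / 2 : ℂ) • (1 + v)) = (1 / 2 : ℂ) • (1 + v) ∧
    ((1 / 2 : ℂ) • (1 - v)) * ((1 / 2 : ℂ) • (1 - v)) = (1 / 2 : ℂ) • (1 - v) ∧
    ((1 / 2 : ℂ) • (1 + v)) * ((1 / 2 : ℂ) • (1 - v)) = 0 ∧
    ((1 / 2 : ℂ) • (1 - v)) * ((1 / 2 : ℂ) • (1 + v)) = 0 := by
  refine ⟨?_, ?_, ?_, ?_⟩ <;>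
  · simp only [smul_mul_smul_comm, mul_add, add_mul, mul_sub, sub_mul, hv.sq, one_mul, mul_one]
    module

theorem IsParity.grading_proj (hv : F.IsParity A v) :
    F.grading ((1 / 2 : ℂ) • (1 + v)) = (1 / 2 : ℂ) • (1 + v) ∧
    F.grading ((1 / 2 : ℂ) • (1 - v)) = (1 / 2 : ℂ) • (1 - v) := by
  constructor <;> simp [hv.grading_eq]

theorem IsParity.proj_mem (hv : F.IsParity A v) :
    (1 / 2 : ℂ) • (1 + v) ∈ F.alg A ∧ (1 / 2 : ℂ) • (1 - v) ∈ F.alg A :=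
  ⟨SMulMemClass.smul_mem _ (add_mem (one_mem _) hv.mem),
    SMulMemClass.smul_mem _ (sub_mem (one_mem _) hv.mem)⟩

theorem proj_comm {x : 𝒜} (hx : v * x = x * v) :
    ((1 / 2 : ℂ) • (1 + v)) * x = x * ((1 / 2 : ℂ) • (1 + v)) ∧
    ((1 / 2 : ℂ) • (1 - v)) * x = x * ((1 / 2 : ℂ) • (1 - v)) := by
  constructor <;>
  simp only [smul_mul_assoc, mul_smul_comm, add_mul, mul_add, sub_mul, mul_sub, hx, one_mul,
    mul_one]

theorem IsParity.grading_comm (hv : F.IsParity A v) {x : 𝒜} (hx : v * x = x * v) :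
    v * F.grading x = F.grading x * v := by
  have h := congrArg F.grading hx
  rwa [map_mul, map_mul, hv.grading_eq] at h

/-- The Klein transform is the identity cut down by the projection `(1 + v) / 2` plus the grading
cut down by `(1 - v) / 2`. Commutation of `x` with `v` makes the cross terms vanish, and each
summand is multiplicative. -/
theorem IsParity.klein_mul (hv : F.IsParity A v) {x y : 𝒜} (hx : v * x = x * v) :
    F.klein v (x * y) = F.klein v x * F.klein v y := by
  obtain ⟨hPP, hQQ, hPQ, hQP⟩ := hv.proj_mul_proj
  have hPx := (proj_comm hx).1
  have hQx := (proj_comm hx).2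
  have hPgx := (proj_comm (hv.grading_comm hx)).1
  have hQgx := (proj_comm (hv.grading_comm hx)).2
  unfold klein
  generalize (1 / 2 : ℂ) • (1 + v) = P at *
  generalize (1 / 2 : ℂ) • (1 - v) = Q at *
  have e1 : P * x * (P * y) = P * (x * y) := by
    rw [hPx, mul_assoc, ← mul_assoc P, hPP, ← mul_assoc, ← hPx, mul_assoc]
  have e2 : P * x * (Q * F.grading y) = 0 := by
    rw [hPx, mul_assoc, ← mul_assoc P, hPQ, zero_mul, mul_zero]
  have e3 : Q * F.grading x * (P * y) = 0 := by
    rw [hQgx, mul_assoc, ← mul_assoc Q, hQP, zero_mul, mul_zero]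
  have e4 : Q * F.grading x * (Q * F.grading y) = Q * (F.grading x * F.grading y) := by
    rw [hQgx, mul_assoc, ← mul_assoc Q, hQQ, ← mul_assoc, ← hQgx, mul_assoc]
  rw [add_mul, mul_add, mul_add, e1, e2, e3, e4, map_mul, add_zero, zero_add]

theorem IsParity.klein_star (hv : F.IsParity A v) {x : 𝒜} (hx : v * x = x * v) :
    F.klein v (star x) = star (F.klein v x) := by
  have hs : star ((1 / 2 : ℂ) • (1 + v)) = (1 / 2 : ℂ) • (1 + v) ∧
      star ((1 / 2 : ℂ) • (1 - v)) = (1 / 2 : ℂ) • (1 - v) := by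
    constructor <;> simp [hv.star_eq]
  unfold klein
  rw [(proj_comm hx).1, (proj_comm (hv.grading_comm hx)).2, star_add, star_mul, star_mul,
    hs.1, hs.2, map_star]

theorem klein_algebraMap (r : ℂ) :
    F.klein v (algebraMap ℂ 𝒜 r) = algebraMap ℂ 𝒜 r := by
  have h : F.grading (algebraMap ℂ 𝒜 r) = algebraMap ℂ 𝒜 r := by
    rw [Algebra.algebraMap_eq_smul_one, map_smul, map_one]
  rw [klein, h, ← add_mul, proj_add, one_mul]

theorem klein_c (i : Γ) : F.klein v (F.c i) = v * F.c i := by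
  rw [klein, F.grading_c, mul_neg, ← sub_eq_add_neg, ← sub_mul]
  congr 1
  module

/-- The Klein transform is inverted by the same formula. -/
theorem IsParity.eq_klein (hv : F.IsParity A v) (x : 𝒜) :
    x = (1 / 2 : ℂ) • (1 + v) * F.klein v x + (1 / 2 : ℂ) • (1 - v) * F.klein v (F.grading x) := by
  obtain ⟨hPP, hQQ, hPQ, hQP⟩ := hv.proj_mul_proj
  have h1 := proj_add (v := v)
  unfold klein
  rw [F.grading_grading]
  generalize (1 / 2 : ℂ) • (1 + v) = P at *
  generalize (1 / 2 : ℂ) • (1 - v) = Q at *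
  rw [mul_add, mul_add, ← mul_assoc, ← mul_assoc, ← mul_assoc, ← mul_assoc, hPP, hPQ, hQP, hQQ,
    zero_mul, add_zero, zero_add, ← add_mul, h1, one_mul]

/-- The grading fixes `(1 - v) / 2`, so evenness removes it from the second summand, and the two
projections add up to one. -/
theorem IsParity.apply_klein (hv : F.IsParity A v) {φ : StrongDual ℂ 𝒜} (hφ : F.IsEven φ) (x : 𝒜) :
    φ (F.klein v x) = φ x := by
  have h : φ ((1 / 2 : ℂ) • (1 - v) * F.grading x) = φ ((1 / 2 : ℂ) • (1 - v) * x) := by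
    rw [← hφ ((1 / 2 : ℂ) • (1 - v) * x), map_mul F.grading, hv.grading_proj.2]
  rw [klein, map_add, h, ← map_add, ← add_mul, proj_add, one_mul]

/-- A product state factorizes with the Klein transform of the second factor. -/
theorem IsParity.apply_mul_klein (hv : F.IsParity A v) {φ ω : StrongDual ℂ 𝒜} (hφ : F.IsEven φ)
    (hω : IsProductState F.alg φ A ω) {a b : 𝒜} (ha : a ∈ F.alg A)
    (hb : b ∈ regionAlgebra F.alg (A : Set Γ)ᶜ) : ω (a * F.klein v b) = φ a * φ b := by
  rw [klein, mul_add, ← mul_assoc, ← mul_assoc, map_add,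
    hω.map_mul _ (mul_mem ha hv.proj_mem.1) _ hb,
    hω.map_mul _ (mul_mem ha hv.proj_mem.2) _ (F.grading_mem_regionAlgebra hb), hφ, ← add_mul,
    ← map_add, ← mul_add, proj_add, mul_one]

/-- Both conditions together cut out a closed `⋆`-subalgebra containing the modes outside `A`. They
are proved jointly because the Klein transform is multiplicative and `⋆`-preserving only in the
presence of the first. -/
theorem IsParity.comm_regionAlgebra (hv : F.IsParity A v) {x : 𝒜} (hx : x ∈ regionAlgebra F.alg (A : Set Γ)ᶜ) :
    v * x = x * v ∧ ∀ a ∈ F.alg A, a * F.klein v x = F.klein v x * a := by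
  let S : StarSubalgebra ℂ 𝒜 :=
    { carrier := {x | v * x = x * v ∧ ∀ a ∈ F.alg A, a * F.klein v x = F.klein v x * a}
      mul_mem' := fun {x y} hx hy => by
        refine ⟨by rw [← mul_assoc, hx.1, mul_assoc, hy.1, mul_assoc], fun a ha => ?_⟩
        rw [hv.klein_mul hx.1, ← mul_assoc, hx.2 a ha, mul_assoc, hy.2 a ha, mul_assoc]
      add_mem' := fun {x y} hx hy => by
        refine ⟨by rw [mul_add, add_mul, hx.1, hy.1], fun a ha => ?_⟩
        have e : F.klein v (x + y) = F.klein v x + F.klein v y := by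
          simp only [klein, map_add, mul_add]
          abel
        rw [e, mul_add, add_mul, hx.2 a ha, hy.2 a ha]
      algebraMap_mem' := fun r => by
        refine ⟨(Algebra.commutes r v).symm, fun a _ => ?_⟩
        rw [klein_algebraMap]
        exact (Algebra.commutes r a).symm
      star_mem' := fun {x} hx => by
        constructor
        · have h := congrArg star hx.1
          rw [star_mul, star_mul, hv.star_eq] at h
          exact h.symm
        · intro a ha
          have h := congrArg star (hx.2 (star a) (star_mem ha))
          rw [star_mul, star_mul, star_star, ← hv.klein_star hx.1] at h
          exact h.symm }
  have hclosed : IsClosed (S : Set 𝒜) := by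
    have hg := F.continuous_grading
    have hk : Continuous (F.klein v) := by
      unfold klein
      fun_prop
    have e : (S : Set 𝒜) = {x | v * x = x * v} ∩
        ⋂ a ∈ F.alg A, {x | a * F.klein v x = F.klein v x * a} := by
      ext x
      simp only [Set.mem_inter_iff, Set.mem_iInter, Set.mem_ofPred_eq]
      exact Iff.rfl
    rw [e]
    exact (isClosed_eq (by fun_prop) (by fun_prop)).inter
      (isClosed_biInter fun a _ => isClosed_eq (by fun_prop) (by fun_prop))
  refine regionAlgebra_le hclosed (fun I hI => F.alg_le fun i hi => ?_) hx
  refine ⟨hv.comm i (hI hi), fun a ha => ?_⟩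
  rw [klein_c]
  exact hv.commute_mul_c (hI hi) ha

/-- The Klein transform of a representation commuting with the parity operator. -/
noncomputable def IsParity.kleinRep (hv : F.IsParity A v) {κ : Type*} [Fintype κ] [DecidableEq κ]
    (π : Matrix κ κ ℂ →⋆ₐ[ℂ] 𝒜) (h : ∀ X, v * π X = π X * v) : Matrix κ κ ℂ →⋆ₐ[ℂ] 𝒜 where
  toFun X := F.klein v (π X)
  map_one' := by
    have := klein_algebraMap (F := F) (v := v) 1
    rw [map_one] at this
    rw [map_one, this]
  map_zero' := by simp [klein]
  map_add' X Y := by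
    simp only [klein, map_add, mul_add]
    abel
  map_mul' X Y := by rw [map_mul, hv.klein_mul (h X)]
  commutes' r := by
    have : π (algebraMap ℂ _ r) = algebraMap ℂ 𝒜 r := AlgHomClass.commutes π r
    rw [this, klein_algebraMap]
  map_star' X := by rw [map_star, hv.klein_star (h X)]

end Klein

/-- The argument is that for commuting regions, with the algebra of `I \ A` replaced by its Klein
transform. Product states in the original sense factorize over the transformed pair as well. -/
theorem area_law (F : FermionSystem Γ 𝒜) {φ : StrongDual ℂ 𝒜} (hφ : IsState φ)
    (hev : F.IsEven φ) (A : Finset Γ) {s : ℝ} (hs : 0 ≤ s)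
    (h : mutualEntropy F.alg φ A (A : Set Γ)ᶜ ≤ ((2 * s : ℝ) : EReal)) :
    (∃! ω, IsProductState F.alg φ A ω) ∧
    (∀ ω, IsProductState F.alg φ A ω → ‖ω - φ‖ ^ 2 ≤ 4 * s) ∧
    (∀ a ∈ F.alg A, ∀ b ∈ regionAlgebra F.alg (A : Set Γ)ᶜ, ‖a‖ ≤ 1 → ‖b‖ ≤ 1 →
      ‖φ (a * b) - φ a * φ b‖ ≤ 2 * s ^ (1 / 2 : ℝ)) := by
  classical
  obtain ⟨ι, _, _, π, hπ⟩ := F.exists_rep A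
  obtain ⟨π₁, l, hr₁, hl0, hl1, hπ₁, hS₁⟩ := exists_diagonal_rep hφ π
  rw [hπ] at hr₁ hS₁
  obtain ⟨v, hv⟩ := F.exists_isParity A
  have hmem₁ : ∀ X, π₁ X ∈ F.alg A := fun X => hr₁ ▸ ⟨X, rfl⟩
  have hlocal : ∀ I, ∃ (κ : Type) (_ : Fintype κ) (_ : DecidableEq κ)
      (π₂ : Matrix κ κ ℂ →⋆ₐ[ℂ] 𝒜) (q : κ → ℝ)
      (hc : ∀ a b, Commute (π₁ a) (π₂ b)), (∀ i, 0 ≤ q i) ∧ ∑ i, q i = 1 ∧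
      (∀ X, φ (π₂ X) = ∑ i, (q i : ℂ) * X i i) ∧
      (∀ ω, IsProductState F.alg φ A ω → ∀ a b, ω (π₁ a * π₂ b) = φ (π₁ a) * φ (π₂ b)) ∧
      F.alg I ≤ (prodRep π₁ π₂ hc).range ∧
      -(∑ i, l i * Real.log (l i)) - ∑ j, q j * Real.log (q j) -
        vonNeumannEntropy (prodRep π₁ π₂ hc).range φ ≤ 2 * s := by
    intro I
    set L := I \ A
    have hL : (L : Set Γ) ⊆ (A : Set Γ)ᶜ := fun i hi => (Finset.mem_sdiff.1 hi).2
    obtain ⟨κ, _, _, π', hπ'⟩ := F.exists_rep L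
    obtain ⟨ρ, q, hr₂, hq0, hq1, hρ, hS₂⟩ := exists_diagonal_rep hφ π'
    rw [hπ'] at hr₂ hS₂
    have hmem₂ : ∀ X, ρ X ∈ F.alg L := fun X => hr₂ ▸ ⟨X, rfl⟩
    have hreg : ∀ X, ρ X ∈ regionAlgebra F.alg (A : Set Γ)ᶜ := fun X =>
      le_regionAlgebra _ hL (hmem₂ X)
    -- Since `φ` is invariant under the Klein transform, `π₂` carries the same diagonal density as
    -- `ρ`, and `q` still computes the entropy of the untransformed region `L`.
    let π₂ := hv.kleinRep ρ fun X => (hv.comm_regionAlgebra (hreg X)).1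
    have hk : ∀ X, π₂ X = F.klein v (ρ X) := fun X => rfl
    have hc : ∀ a b, Commute (π₁ a) (π₂ b) := fun a b =>
      (hv.comm_regionAlgebra (hreg b)).2 _ (hmem₁ a)
    have hA : F.alg A ≤ (prodRep π₁ π₂ hc).range := by
      rw [prodRep_range, hr₁]
      exact le_sup_left
    have hA' : F.alg A ≤ F.alg (A ∪ L) := F.alg_mono Finset.subset_union_left
    have hL' : F.alg L ≤ F.alg (A ∪ L) := F.alg_mono Finset.subset_union_right
    have hrange : (prodRep π₁ π₂ hc).range = F.alg (A ∪ L) := by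
      apply le_antisymm
      · rw [prodRep_range, hr₁]
        refine sup_le hA' ?_
        rintro _ ⟨X, rfl⟩
        exact add_mem (mul_mem (hA' hv.proj_mem.1) (hL' (hmem₂ X)))
          (mul_mem (hA' hv.proj_mem.2) (hL' (F.grading_mem_alg (hmem₂ X))))
      · refine F.alg_le fun i hi => ?_
        rcases Finset.mem_union.1 hi with hi | hi
        · exact hA (F.c_mem_alg hi)
        · have hci := F.c_mem_alg hi
          rw [← hr₂] at hci
          obtain ⟨X, hX⟩ := hci
          have hX' : π₂ X = v * F.c i := by
            rw [hk, show ρ X = F.c i from hX, klein_c]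
          have h2 : π₂ X ∈ (prodRep π₁ π₂ hc).range := by
            rw [prodRep_range]
            exact (le_sup_right : π₂.range ≤ π₁.range ⊔ π₂.range) ⟨X, rfl⟩
          -- The parity operator lies in the algebra of `A` and squares to one, so it undoes the
          -- twist and recovers `F.c i`.
          have h3 := mul_mem (hA hv.mem) h2
          rwa [hX', ← hv.c_eq] at h3
    refine ⟨κ, inferInstance, inferInstance, π₂, q, hc, hq0, hq1, fun X => ?_,
      fun ω hω a b => ?_, ?_, ?_⟩
    · rw [hk, hv.apply_klein hev, hρ]
    · rw [hk, hv.apply_klein hev, hv.apply_mul_klein hev hω (hmem₁ a) (hreg b)]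
    · rw [hrange]
      refine F.alg_mono fun i hi => ?_
      simp only [L, Finset.mem_union, Finset.mem_sdiff]
      tauto
    · have hent := entropy_le_of_mutualEntropy_le h hL
      have e : vonNeumannEntropy (prodRep π₁ π₂ hc).range φ =
        vonNeumannEntropy (F.alg (A ∪ L)) φ := by rw [hrange]
      rw [e]
      rw [hS₁, hS₂] at hent
      linarith
  obtain ⟨ω₀, hω₀, hω₀mul⟩ := exists_state_mul_of_commute hφ π₁ hl0 hπ₁
  refine area_law_of_local F.dense ⟨ω₀, hω₀, fun a ha b hb => ?_⟩ ?_ hs ?_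
  · have hk : ∀ a ∈ F.alg A, ∀ b ∈ regionAlgebra F.alg (A : Set Γ)ᶜ,
        ω₀ (a * F.klein v b) = φ a * φ b := by
      intro a ha b hb
      rw [← hr₁] at ha
      obtain ⟨X, rfl⟩ := ha
      rw [← hv.apply_klein hev b]
      exact hω₀mul X _ fun Y => (hv.comm_regionAlgebra hb).2 _ (hmem₁ Y)
    have hb' := F.grading_mem_regionAlgebra hb
    -- The state `ω₀` factorizes over the commutant of `𝒜(A)`, hence over Klein transforms.
    -- Inverting the transform writes `b` through those of `b` and its grading, with coefficients in
    -- `𝒜(A)` that sum to one.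
    conv_lhs => rw [hv.eq_klein b]
    rw [mul_add, ← mul_assoc, ← mul_assoc, map_add, hk _ (mul_mem ha hv.proj_mem.1) _ hb,
      hk _ (mul_mem ha hv.proj_mem.2) _ hb', hev, ← add_mul, ← map_add, ← mul_add, proj_add,
      mul_one]
  · intro ω ω' hω hω' I x hx
    obtain ⟨κ, _, _, π₂, q, hc, -, -, -, hmul, hle, -⟩ := hlocal I
    obtain ⟨X, rfl⟩ := hle hx
    exact eq_on_prodRep π₁ π₂ hc (fun a b => by rw [hmul ω hω, hmul ω' hω']) X
  · intro ω hω I x hx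
    obtain ⟨κ, _, _, π₂, q, hc, hq0, hq1, hπ₂, hmul, hle, hent⟩ := hlocal I
    exact sq_norm_sub_le hφ hω.isState π₁ π₂ hc hl0 hq0 hl1 hq1 hπ₁ hπ₂ (hmul ω hω) hent (hle hx)

end FermionSystem

end FermionAreaLaw

end QuantumLattice

/-! ### The thermal area law for both kinds of lattice systems. -/

theorem corollary2 {Γ 𝒜 : Type*} [CStarAlgebra 𝒜] (β : ℝ) (hβ : 0 < β) (A : Finset Γ) :
    -- quantum spin lattice systems
    (∀ (S : QuantumLattice.SpinSystem Γ 𝒜) (Φ : QuantumLattice.Potential S.alg)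
      (φ : StrongDual ℂ 𝒜), QuantumLattice.IsState φ →
      QuantumLattice.mutualEntropy S.alg φ A (A : Set Γ)ᶜ ≤
        ((2 * β * ‖Φ.surfaceEnergy A‖ : ℝ) : EReal) →
      (∃! ω, QuantumLattice.IsProductState S.alg φ A ω) ∧
      (∀ ω, QuantumLattice.IsProductState S.alg φ A ω →
        ‖ω - φ‖ ^ 2 ≤ 4 * β * ‖Φ.surfaceEnergy A‖) ∧
      (∀ a ∈ S.alg A, ∀ b ∈ QuantumLattice.regionAlgebra S.alg (A : Set Γ)ᶜ,
        ‖a‖ ≤ 1 → ‖b‖ ≤ 1 →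
        ‖φ (a * b) - φ a * φ b‖ ≤ 2 * (β * ‖Φ.surfaceEnergy A‖) ^ (1 / 2 : ℝ))) ∧
    -- fermion lattice systems
    (∀ (F : QuantumLattice.FermionSystem Γ 𝒜) (Φ : QuantumLattice.Potential F.alg)
      (φ : StrongDual ℂ 𝒜), (∀ K, F.grading (Φ.toFun K) = Φ.toFun K) →
      QuantumLattice.IsState φ → F.IsEven φ →
      QuantumLattice.mutualEntropy F.alg φ A (A : Set Γ)ᶜ ≤
        ((2 * β * ‖Φ.surfaceEnergy A‖ : ℝ) : EReal) →
      (∃! ω, QuantumLattice.IsProductState F.alg φ A ω) ∧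
      (∀ ω, QuantumLattice.IsProductState F.alg φ A ω →
        ‖ω - φ‖ ^ 2 ≤ 4 * β * ‖Φ.surfaceEnergy A‖) ∧
      (∀ a ∈ F.alg A, ∀ b ∈ QuantumLattice.regionAlgebra F.alg (A : Set Γ)ᶜ,
        ‖a‖ ≤ 1 → ‖b‖ ≤ 1 →
        ‖φ (a * b) - φ a * φ b‖ ≤ 2 * (β * ‖Φ.surfaceEnergy A‖) ^ (1 / 2 : ℝ))) := by
  refine ⟨fun S Φ φ hφ h => ?_, fun F Φ φ _ hφ hev h => ?_⟩
  · have hs : 0 ≤ β * ‖Φ.surfaceEnergy A‖ := mul_nonneg hβ.le (norm_nonneg _)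
    rw [mul_assoc] at h
    simpa only [mul_assoc] using S.area_law hφ A hs h
  · have hs : 0 ≤ β * ‖Φ.surfaceEnergy A‖ := mul_nonneg hβ.le (norm_nonneg _)
    rw [mul_assoc] at h
    simpa only [mul_assoc] using F.area_law hφ hev A hs h
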